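/- Let $k$ be an infinite field. For integers $1<n$, $1\le\nu<N$ with $n\mid N$, $\gcd(n,\nu)=1$, $N\nmid \nu n$, a primitive $n$-th root of unity $q\in k$, and $\alpha,\beta,\gamma\in k$, let $\mathcal U_{(n,N,\nu,q,\alpha,\beta,\gamma)}$ be the Hopf algebra over $k$ generated as an algebra by $a,x,y$ with relations $$a^N=1,\quad x^n=\alpha(a^{\nu n}-1),\quad y^n=\beta(a^{\nu n}-1),\quad xa=qax,\quad ya=q^{-1}ay,\quad yx-q^{-\nu}xy=\gamma(a^{2\nu}-1),$$ with $\Delta(a)=a\otimes a$, $\Delta(x)=x\otimes a^\nu+1\otimes x$, $\Delta(y)=y\otimes a^\nu+1\otimes y$, $\varepsilon(a)=1$, $\varepsilon(x)=\varepsilon(y)=0$, and antipode $s(a)=a^{-1}$, $s(x)=-q^{-\nu}a^{-\nu}x$, $s(y)=-q^{\nu}a^{-\nu}y$. (1) If $k$ contains a primitive $n$-th root of unity for some $n>2$, then Kaplansky's 10th conjecture fails over $k$: it is not true that for every $d$ there are, up to isomorphism, only finitely many Hopf algebras of dimension $d$ over $k$. (2) More precisely, let $2<n<N$ be integers with $n\mid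 N$ and let $q\in k$ be a primitive $n$-th root of unity. Then there are infinitely many pairwise non-isomorphic Hopf algebras of dimension $Nn^2$ over $k$. In fact there exist integers $\nu$ such that $1\le\nu<N$, $\gcd(n,\nu)=1$ and $N\nmid\nu n$; and for every such $\nu$, all the Hopf algebras $\mathcal U_{(n,N,\nu,q,\alpha,\beta,\gamma)}$ with $\alpha,\beta,\gamma\in k\setminus\{0\}$ have dimension $Nn^2$, and infinitely many of them are pairwise non-isomorphic as Hopf algebras. -/

import Mathlib

universe u

open scoped TensorProduct

namespace GelakiHopf

/-! ### Two identities for `ω`-commuting elements -/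

section Commutation

variable {k : Type*} [Field k] {A : Type*} [Ring A] [Algebra k A]

theorem mul_pow_comm {ω : k} {z g : A} (h : z * g = ω • (g * z)) (m : ℕ) :
    z * g ^ m = ω ^ m • (g ^ m * z) := by
  induction m with
  | zero => simp
  | succ m ih =>
    rw [pow_succ, ← mul_assoc, ih, smul_mul_assoc, mul_assoc, h, mul_smul_comm, smul_smul,
      ← pow_succ, mul_assoc]

theorem pow_mul_comm {ω : k} {z g : A} (h : z * g = ω • (g * z)) (m : ℕ) :
    z ^ m * g = ω ^ m • (g * z ^ m) := by
  induction m with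
  | zero => simp
  | succ m ih =>
    rw [pow_succ', mul_assoc, ih, mul_smul_comm, ← mul_assoc, h, smul_mul_assoc, smul_smul,
      mul_assoc, ← pow_succ]

theorem mul_pow_eq {ω : k} {z g : A} (h : z * g = ω • (g * z)) (m : ℕ) :
    (g * z) ^ m = ω ^ (m.choose 2) • (g ^ m * z ^ m) := by
  induction m with
  | zero => simp
  | succ m ih =>
    have e : (m + 1).choose 2 = m.choose 2 + m := by
      rw [Nat.choose_succ_succ' m 1, Nat.choose_one_right, add_comm]
    rw [pow_succ (g * z), ih, smul_mul_assoc, mul_assoc, ← mul_assoc (z ^ m), pow_mul_comm h,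
      smul_mul_assoc, mul_smul_comm, smul_smul, ← pow_add, ← e, pow_succ g, pow_succ z]
    simp only [mul_assoc]

theorem primitiveRoot_pow_choose_two {ω : k} {n : ℕ} (hn : 0 < n) (hω : IsPrimitiveRoot ω n) :
    (-ω) ^ n * ω ^ (n.choose 2) = -1 := by
  rcases Nat.even_or_odd' n with ⟨m, rfl | rfl⟩
  · have hm : 0 < m := by omega
    have h1 : ω ^ m = -1 := by
      have h2 : (ω ^ m - 1) * (ω ^ m + 1) = 0 := by
        have := hω.pow_eq_one
        rw [pow_mul', sq] at this
        linear_combination this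
      rcases mul_eq_zero.mp h2 with h | h
      · exact absurd (sub_eq_zero.mp h) (hω.pow_ne_one_of_pos_of_lt hm.ne' (by omega))
      · exact eq_neg_of_add_eq_zero_left h
    have e : (2 * m).choose 2 = m * (2 * m - 1) := by
      rw [Nat.choose_two_right, mul_assoc, Nat.mul_div_cancel_left _ (by norm_num)]
    rw [Even.neg_pow ⟨m, by ring⟩, hω.pow_eq_one, e, pow_mul, h1, one_mul]
    exact Odd.neg_one_pow ⟨m - 1, by omega⟩
  · have e : (2 * m + 1).choose 2 = (2 * m + 1) * m := by
      rw [Nat.choose_two_right, Nat.add_sub_cancel, mul_left_comm,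
        Nat.mul_div_cancel_left _ (by norm_num)]
    rw [Odd.neg_pow ⟨m, rfl⟩, hω.pow_eq_one, e, pow_mul, hω.pow_eq_one, one_pow, mul_one]

theorem neg_smul_mul_pow {ω : k} {n : ℕ} (hn : 0 < n) (hω : IsPrimitiveRoot ω n) {z g : A}
    (h : z * g = ω • (g * z)) : ((-ω) • (g * z)) ^ n = -(g ^ n * z ^ n) := by
  rw [smul_pow, mul_pow_eq h, smul_smul, primitiveRoot_pow_choose_two hn hω, neg_smul, one_smul]

/-- Gaussian binomial coefficients, by their Pascal recursion. -/
def gaussCoeff (ω : k) : ℕ → ℕ → k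
  | _, 0 => 1
  | 0, _ + 1 => 0
  | m + 1, j + 1 => gaussCoeff ω m j + ω ^ (j + 1) * gaussCoeff ω m (j + 1)

theorem gaussCoeff_zero_right (ω : k) (m : ℕ) : gaussCoeff ω m 0 = 1 := by
  cases m <;> rfl

theorem gaussCoeff_succ_succ (ω : k) (m j : ℕ) :
    gaussCoeff ω (m + 1) (j + 1)
      = gaussCoeff ω m j + ω ^ (j + 1) * gaussCoeff ω m (j + 1) := rfl

theorem gaussCoeff_eq_zero (ω : k) : ∀ (m j : ℕ), m < j → gaussCoeff ω m j = 0
  | _, 0, h => absurd h (by omega)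
  | 0, _ + 1, _ => rfl
  | m + 1, j + 1, h => by
    rw [gaussCoeff_succ_succ, gaussCoeff_eq_zero ω m j (by omega),
      gaussCoeff_eq_zero ω m (j + 1) (by omega)]
    simp

theorem gaussCoeff_self (ω : k) : ∀ m : ℕ, gaussCoeff ω m m = 1
  | 0 => rfl
  | m + 1 => by
    rw [gaussCoeff_succ_succ, gaussCoeff_self ω m, gaussCoeff_eq_zero ω m (m + 1) (by omega)]
    simp

theorem gaussCoeff_mul (ω : k) (m : ℕ) : ∀ j : ℕ,
    (1 - ω ^ (j + 1)) * gaussCoeff ω (m + 1) (j + 1) = (1 - ω ^ (m + 1)) * gaussCoeff ω m j := by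
  induction m with
  | zero =>
    intro j
    cases j with
    | zero => simp [gaussCoeff]
    | succ j => simp [gaussCoeff]
  | succ m ih =>
    intro j
    have h1 := ih j
    cases j with
    | zero =>
      rw [gaussCoeff_succ_succ ω (m + 1) 0]
      simp only [gaussCoeff_zero_right] at h1 ⊢
      linear_combination ω * h1
    | succ j =>
      have h2 := ih j
      have h3 := gaussCoeff_succ_succ ω m j
      rw [gaussCoeff_succ_succ ω (m + 1) (j + 1)]
      linear_combination ω ^ (j + 2) * h1 + ω * h2 - ω * (1 - ω ^ (m + 1)) * h3

theorem gaussCoeff_primitiveRoot {ω : k} {n : ℕ} (hω : IsPrimitiveRoot ω n) {j : ℕ}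
    (h0 : 0 < j) (hj : j < n) : gaussCoeff ω n j = 0 := by
  obtain ⟨m, rfl⟩ : ∃ m, n = m + 1 := ⟨n - 1, by omega⟩
  obtain ⟨i, rfl⟩ : ∃ i, j = i + 1 := ⟨j - 1, by omega⟩
  have h := gaussCoeff_mul ω m i
  rw [hω.pow_eq_one, sub_self, zero_mul] at h
  refine (mul_eq_zero.mp h).resolve_left fun h' => ?_
  exact hω.pow_ne_one_of_pos_of_lt (by omega) hj (sub_eq_zero.mp h').symm

theorem add_pow_eq_sum {ω : k} {a b : A} (h : b * a = ω • (a * b)) (m : ℕ) :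
    (a + b) ^ m = ∑ j ∈ Finset.range (m + 1), gaussCoeff ω m j • (a ^ j * b ^ (m - j)) := by
  induction m with
  | zero => simp [gaussCoeff]
  | succ m ih =>
    have e1 : ∀ j, a * (gaussCoeff ω m j • (a ^ j * b ^ (m - j)))
        = gaussCoeff ω m j • (a ^ (j + 1) * b ^ (m - j)) := fun j => by
      rw [mul_smul_comm, ← mul_assoc, ← pow_succ']
    have e2 : ∀ j ∈ Finset.range (m + 1), b * (gaussCoeff ω m j • (a ^ j * b ^ (m - j)))
        = (ω ^ j * gaussCoeff ω m j) • (a ^ j * b ^ (m + 1 - j)) := fun j hj => by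
      have hj' : j ≤ m := by simpa [Nat.lt_succ_iff] using hj
      rw [mul_smul_comm, ← mul_assoc, mul_pow_comm h, smul_mul_assoc, smul_smul, mul_assoc,
        ← pow_succ', mul_comm, Nat.sub_add_comm hj']
    rw [pow_succ', ih, add_mul, Finset.mul_sum, Finset.mul_sum, Finset.sum_congr rfl e2,
      Finset.sum_congr rfl (fun j _ => e1 j), Finset.sum_range_succ' _ (m + 1)]
    have e3 : ∑ j ∈ Finset.range (m + 1), (ω ^ j * gaussCoeff ω m j) • (a ^ j * b ^ (m + 1 - j))
        = ∑ j ∈ Finset.range (m + 1),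
            (ω ^ (j + 1) * gaussCoeff ω m (j + 1)) • (a ^ (j + 1) * b ^ (m + 1 - (j + 1)))
          + b ^ (m + 1) := by
      have := Finset.sum_range_succ'
        (fun j => (ω ^ j * gaussCoeff ω m j) • (a ^ j * b ^ (m + 1 - j))) (m + 1)
      rw [Finset.sum_range_succ, gaussCoeff_eq_zero ω m (m + 1) (by omega)] at this
      simpa [gaussCoeff_zero_right] using this
    rw [e3, ← add_assoc, ← Finset.sum_add_distrib]
    congr 1
    · refine Finset.sum_congr rfl fun j _ => ?_
      rw [gaussCoeff_succ_succ, add_smul, Nat.add_sub_add_right]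
    · simp [gaussCoeff_zero_right]

theorem add_pow_primitiveRoot {ω : k} {n : ℕ} (hn : 0 < n) (hω : IsPrimitiveRoot ω n) {a b : A}
    (h : b * a = ω • (a * b)) : (a + b) ^ n = a ^ n + b ^ n := by
  rw [add_pow_eq_sum h, Finset.sum_range_succ, gaussCoeff_self]
  obtain ⟨m, rfl⟩ : ∃ m, n = m + 1 := ⟨n - 1, by omega⟩
  rw [Finset.sum_range_succ', Finset.sum_eq_zero]
  · simp [gaussCoeff_zero_right, add_comm]
  · intro j hj
    rw [gaussCoeff_primitiveRoot hω (Nat.succ_pos j) (by simpa using hj), zero_smul]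

end Commutation

/-! ### The algebras `U_(n,N,ν,q,α,β,γ)` -/

/-- The standing assumptions on the discrete parameters: `n > 1`, `n ∣ N`, `1 ≤ ν < N`,
`(n, ν) = 1`, `N ∤ νn`, and `q` is a primitive `n`-th root of unity. -/
class Admissible {k : Type u} [Field k] (n N ν : ℕ) (q : k) : Prop where
  one_lt : 1 < n
  dvd : n ∣ N
  one_le : 1 ≤ ν
  lt : ν < N
  coprime : Nat.Coprime n ν
  not_dvd : ¬ N ∣ ν * n
  primitive : IsPrimitiveRoot q n

/-- Names of the three generators. -/
inductive Gen : Type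
  | a
  | x
  | y

section Family

variable {k : Type u} [Field k] (n N ν : ℕ) (q α β γ : k)

/-- The defining relations, for three elements of an arbitrary `k`-algebra. -/
structure Relations {A : Type*} [Ring A] [Algebra k A] (a x y : A) : Prop where
  a_pow : a ^ N = 1
  x_pow : x ^ n = α • (a ^ (ν * n) - 1)
  y_pow : y ^ n = β • (a ^ (ν * n) - 1)
  x_a : x * a = q • (a * x)
  y_a : y * a = q⁻¹ • (a * y)
  y_x : y * x - (q ^ ν)⁻¹ • (x * y) = γ • (a ^ (2 * ν) - 1)

/-- The same relations, in the free algebra on `a`, `x`, `y`. -/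
inductive Rel : FreeAlgebra k Gen → FreeAlgebra k Gen → Prop
  | a_pow : Rel (FreeAlgebra.ι k Gen.a ^ N) 1
  | x_pow : Rel (FreeAlgebra.ι k Gen.x ^ n) (α • (FreeAlgebra.ι k Gen.a ^ (ν * n) - 1))
  | y_pow : Rel (FreeAlgebra.ι k Gen.y ^ n) (β • (FreeAlgebra.ι k Gen.a ^ (ν * n) - 1))
  | x_a : Rel (FreeAlgebra.ι k Gen.x * FreeAlgebra.ι k Gen.a)
      (q • (FreeAlgebra.ι k Gen.a * FreeAlgebra.ι k Gen.x))
  | y_a : Rel (FreeAlgebra.ι k Gen.y * FreeAlgebra.ι k Gen.a)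
      (q⁻¹ • (FreeAlgebra.ι k Gen.a * FreeAlgebra.ι k Gen.y))
  | y_x : Rel (FreeAlgebra.ι k Gen.y * FreeAlgebra.ι k Gen.x
        - (q ^ ν)⁻¹ • (FreeAlgebra.ι k Gen.x * FreeAlgebra.ι k Gen.y))
      (γ • (FreeAlgebra.ι k Gen.a ^ (2 * ν) - 1))

/-- The algebra `U_(n,N,ν,q,α,β,γ)`: generators `a, x, y`, and relations
`a^N = 1`, `x^n = α(a^(νn) - 1)`, `y^n = β(a^(νn) - 1)`, `xa = qax`, `ya = q⁻¹ay`,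
`yx - q^(-ν)xy = γ(a^(2ν) - 1)`. -/
def U : Type u := RingQuot (Rel n N ν q α β γ)

namespace U

noncomputable instance : Ring (U n N ν q α β γ) :=
  inferInstanceAs (Ring (RingQuot (Rel n N ν q α β γ)))

noncomputable instance : Algebra k (U n N ν q α β γ) :=
  inferInstanceAs (Algebra k (RingQuot (Rel n N ν q α β γ)))

/-- The quotient map from the free algebra. -/
noncomputable def mk : FreeAlgebra k Gen →ₐ[k] U n N ν q α β γ :=
  RingQuot.mkAlgHom k (Rel n N ν q α β γ)

/-- The generator `a`. -/
noncomputable def a : U n N ν q α β γ := mk n N ν q α β γ (FreeAlgebra.ι k Gen.a)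

/-- The generator `x`. -/
noncomputable def x : U n N ν q α β γ := mk n N ν q α β γ (FreeAlgebra.ι k Gen.x)

/-- The generator `y`. -/
noncomputable def y : U n N ν q α β γ := mk n N ν q α β γ (FreeAlgebra.ι k Gen.y)

theorem mk_rel {s t : FreeAlgebra k Gen} (h : Rel n N ν q α β γ s t) :
    mk n N ν q α β γ s = mk n N ν q α β γ t :=
  RingQuot.mkAlgHom_rel k h

theorem relations :
    Relations n N ν q α β γ (a n N ν q α β γ) (x n N ν q α β γ) (y n N ν q α β γ) where
  a_pow := by simpa [a, x, y] using mk_rel n N ν q α β γ Rel.a_pow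
  x_pow := by simpa [a, x, y] using mk_rel n N ν q α β γ Rel.x_pow
  y_pow := by simpa [a, x, y] using mk_rel n N ν q α β γ Rel.y_pow
  x_a := by simpa [a, x, y] using mk_rel n N ν q α β γ Rel.x_a
  y_a := by simpa [a, x, y] using mk_rel n N ν q α β γ Rel.y_a
  y_x := by simpa [a, x, y] using mk_rel n N ν q α β γ Rel.y_x

variable {n N ν q α β γ}

/-- Assignment of the generators. -/
def assign {A : Type*} (a x y : A) : Gen → A
  | Gen.a => a
  | Gen.x => x
  | Gen.y => y

/-- The universal property. -/
noncomputable def lift {A : Type*} [Ring A] [Algebra k A] {a' x' y' : A}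
    (h : Relations n N ν q α β γ a' x' y') : U n N ν q α β γ →ₐ[k] A :=
  RingQuot.liftAlgHom k ⟨FreeAlgebra.lift k (assign a' x' y'), by
    intro r s hrs
    cases hrs with
    | a_pow => simpa [assign] using h.a_pow
    | x_pow => simpa [assign] using h.x_pow
    | y_pow => simpa [assign] using h.y_pow
    | x_a => simpa [assign] using h.x_a
    | y_a => simpa [assign] using h.y_a
    | y_x => simpa [assign] using h.y_x⟩

section LiftLemmas

variable {A : Type*} [Ring A] [Algebra k A] {a' x' y' : A}
  (h : Relations n N ν q α β γ a' x' y')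

theorem lift_mk (z : FreeAlgebra k Gen) :
    lift h (mk n N ν q α β γ z) = FreeAlgebra.lift k (assign a' x' y') z := by
  unfold lift mk
  exact RingQuot.liftAlgHom_mkAlgHom_apply k _ _ z

@[simp] theorem lift_a : lift h (a n N ν q α β γ) = a' := by
  rw [a, lift_mk]; simp [assign]

@[simp] theorem lift_x : lift h (x n N ν q α β γ) = x' := by
  rw [x, lift_mk]; simp [assign]

@[simp] theorem lift_y : lift h (y n N ν q α β γ) = y' := by
  rw [y, lift_mk]; simp [assign]

end LiftLemmas

theorem mk_surjective : Function.Surjective (mk n N ν q α β γ) :=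
  RingQuot.mkAlgHom_surjective k _

/-- Every element is a noncommutative polynomial in the generators. -/
theorem induction {P : U n N ν q α β γ → Prop}
    (hk : ∀ r : k, P (algebraMap k _ r))
    (ha : P (a n N ν q α β γ)) (hx : P (x n N ν q α β γ)) (hy : P (y n N ν q α β γ))
    (hmul : ∀ z w, P z → P w → P (z * w)) (hadd : ∀ z w, P z → P w → P (z + w))
    (z : U n N ν q α β γ) : P z := by
  obtain ⟨z, rfl⟩ := mk_surjective z
  induction z using FreeAlgebra.induction with
  | grade0 r => simpa using hk r
  | grade1 i =>
    cases i
    · exact ha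
    · exact hx
    · exact hy
  | mul z w hz hw => simpa using hmul _ _ hz hw
  | add z w hz hw => simpa using hadd _ _ hz hw

theorem algHom_ext {A : Type*} [Semiring A] [Algebra k A] {f g : U n N ν q α β γ →ₐ[k] A}
    (ha : f (a n N ν q α β γ) = g (a n N ν q α β γ))
    (hx : f (x n N ν q α β γ) = g (x n N ν q α β γ))
    (hy : f (y n N ν q α β γ) = g (y n N ν q α β γ)) : f = g := by
  refine AlgHom.ext fun z => ?_
  induction z using U.induction with
  | hk r => simp
  | ha => exact ha
  | hx => exact hx
  | hy => exact hy
  | hmul z w hz hw => rw [map_mul, map_mul, hz, hw]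
  | hadd z w hz hw => rw [map_add, map_add, hz, hw]

/-! ### The Hopf algebra structure -/

end U

end Family

theorem Relations.tensor {k : Type u} [Field k] {n N ν : ℕ} {q α β γ : k} [Admissible n N ν q]
    {A : Type*} [Ring A] [Algebra k A] {a x y : A} (h : Relations n N ν q α β γ a x y) :
    Relations n N ν q α β γ (a ⊗ₜ[k] a) (x ⊗ₜ[k] (a ^ ν) + 1 ⊗ₜ[k] x)
      (y ⊗ₜ[k] (a ^ ν) + 1 ⊗ₜ[k] y) := by
  have hn : 0 < n := lt_trans one_pos (Admissible.one_lt N ν q)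
  have hq : IsPrimitiveRoot q n := Admissible.primitive N ν
  have hq0 : q ≠ 0 := hq.ne_zero hn.ne'
  have hqν : IsPrimitiveRoot (q ^ ν) n := hq.pow_of_coprime ν (Admissible.coprime N q).symm
  have hqν' : IsPrimitiveRoot ((q⁻¹) ^ ν) n :=
    hq.inv.pow_of_coprime ν (Admissible.coprime N q).symm
  have hxν : x * a ^ ν = q ^ ν • (a ^ ν * x) := mul_pow_comm h.x_a ν
  have hyν : y * a ^ ν = (q⁻¹) ^ ν • (a ^ ν * y) := mul_pow_comm h.y_a ν
  have key : ∀ (z : A) (δ : k), z ^ n = δ • (a ^ (ν * n) - 1) →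
      (z ^ n) ⊗ₜ[k] ((a ^ ν) ^ n) + 1 ⊗ₜ[k] (z ^ n)
        = δ • ((a ^ (ν * n)) ⊗ₜ[k] (a ^ (ν * n)) - 1 : A ⊗[k] A) := by
    intro z δ hz
    rw [hz, ← pow_mul, TensorProduct.tmul_smul,
      ← TensorProduct.smul_tmul', ← smul_add, TensorProduct.sub_tmul, TensorProduct.tmul_sub,
      Algebra.TensorProduct.one_def]
    congr 1
    abel
  constructor
  · simp [h.a_pow, Algebra.TensorProduct.one_def]
  · rw [add_pow_primitiveRoot hn hqν]
    · simpa using key x α h.x_pow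
    · simp [hxν]
  · rw [add_pow_primitiveRoot hn hqν']
    · simpa using key y β h.y_pow
    · simp [hyν]
  · simp [add_mul, mul_add, h.x_a, ← pow_succ, ← pow_succ', TensorProduct.smul_tmul']
  · simp [add_mul, mul_add, h.y_a, ← pow_succ, ← pow_succ', TensorProduct.smul_tmul']
  · have e : y * x = (q ^ ν)⁻¹ • (x * y) + γ • (a ^ (2 * ν) - 1) := by
      rw [← h.y_x]; abel
    simp only [add_mul, mul_add, Algebra.TensorProduct.tmul_mul_tmul, one_mul, mul_one, hxν, hyν,
      e, Algebra.TensorProduct.tmul_pow, ← pow_add, ← two_mul, TensorProduct.add_tmul,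
      TensorProduct.tmul_add, TensorProduct.tmul_smul, ← TensorProduct.smul_tmul',
      TensorProduct.sub_tmul, TensorProduct.tmul_sub, smul_add, smul_sub, smul_smul, inv_pow,
      Algebra.TensorProduct.one_def]
    rw [inv_mul_cancel₀ (pow_ne_zero ν hq0), one_smul]
    abel

theorem Relations.counit {k : Type u} [Field k] {n N ν : ℕ} {q α β γ : k} [Admissible n N ν q] :
    Relations n N ν q α β γ (1 : k) 0 0 := by
  have hn : n ≠ 0 := (lt_trans one_pos (Admissible.one_lt N ν q)).ne'
  constructor <;> simp [hn]

theorem Relations.antipode {k : Type u} [Field k] {n N ν : ℕ} {q α β γ : k} [Admissible n N ν q]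
    {A : Type*} [Ring A] [Algebra k A] {a x y : A} (h : Relations n N ν q α β γ a x y) :
    Relations n N ν q α β γ (MulOpposite.op (a ^ (N - 1)))
      (MulOpposite.op (-(q ^ ν)⁻¹ • ((a ^ (N - 1)) ^ ν * x)))
      (MulOpposite.op (-(q ^ ν) • ((a ^ (N - 1)) ^ ν * y))) := by
  have hn : 0 < n := lt_trans one_pos (Admissible.one_lt N ν q)
  have hN : 0 < N := lt_of_le_of_lt (Nat.zero_le ν) (Admissible.lt n q)
  have hq : IsPrimitiveRoot q n := Admissible.primitive N ν
  have hq0 : q ≠ 0 := hq.ne_zero hn.ne'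
  have hqν : IsPrimitiveRoot (q ^ ν) n := hq.pow_of_coprime ν (Admissible.coprime N q).symm
  have hqN : q ^ N = 1 := (hq.pow_eq_one_iff_dvd N).mpr (Admissible.dvd ν q)
  have hqN1 : q ^ (N - 1) = q⁻¹ := by
    rw [pow_sub₀ _ hq0 hN, hqN, one_mul, pow_one]
  obtain ⟨b, hb⟩ : ∃ b, b = a ^ (N - 1) := ⟨_, rfl⟩
  rw [← hb]
  have hba : b * a = 1 := by rw [hb, ← pow_succ, Nat.sub_add_cancel hN, h.a_pow]
  have hab : a * b = 1 := by rw [hb, ← pow_succ', Nat.sub_add_cancel hN, h.a_pow]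
  have hcom : Commute b a := hba.trans hab.symm
  have hxb : x * b = q⁻¹ • (b * x) := by rw [hb, mul_pow_comm h.x_a, hqN1]
  have hyb : y * b = q • (b * y) := by
    rw [hb, mul_pow_comm h.y_a, inv_pow, hqN1, inv_inv]
  have hpow : ∀ m, b ^ m * a ^ m = 1 := fun m => by rw [← hcom.mul_pow, hba, one_pow]
  have hxg : x * b ^ ν = (q ^ ν)⁻¹ • (b ^ ν * x) := by rw [mul_pow_comm hxb, inv_pow]
  have hyg : y * b ^ ν = q ^ ν • (b ^ ν * y) := mul_pow_comm hyb ν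
  have key : ∀ (m : ℕ) (δ : k), -(b ^ m * (δ • (a ^ m - 1))) = δ • (b ^ m - 1) := by
    intro m δ
    rw [mul_smul_comm, mul_sub, hpow, mul_one, ← smul_neg, neg_sub]
  constructor
  · rw [← MulOpposite.op_pow, hb, ← pow_mul, mul_comm, pow_mul, h.a_pow, one_pow]
    rfl
  · rw [← MulOpposite.op_pow, neg_smul_mul_pow hn hqν.inv hxg, h.x_pow, ← pow_mul, key]
    rfl
  · rw [← MulOpposite.op_pow, neg_smul_mul_pow hn hqν hyg, h.y_pow, ← pow_mul, key]
    rfl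
  · rw [← MulOpposite.op_mul, ← MulOpposite.op_mul, ← MulOpposite.op_smul, smul_mul_assoc,
      mul_smul_comm, mul_assoc, hxb, mul_smul_comm, smul_comm q, smul_smul q,
      mul_inv_cancel₀ hq0, one_smul, ← mul_assoc, ← mul_assoc, ← pow_succ, ← pow_succ']
  · rw [← MulOpposite.op_mul, ← MulOpposite.op_mul, ← MulOpposite.op_smul, smul_mul_assoc,
      mul_smul_comm, mul_assoc, hyb, mul_smul_comm, smul_comm q⁻¹, smul_smul q⁻¹,
      inv_mul_cancel₀ hq0, one_smul, ← mul_assoc, ← mul_assoc, ← pow_succ, ← pow_succ']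
  · have e1 : (-(q ^ ν)⁻¹ • (b ^ ν * x)) * (-(q ^ ν) • (b ^ ν * y))
        = (q ^ ν)⁻¹ • (b ^ (2 * ν) * (x * y)) := by
      rw [smul_mul_smul_comm, neg_mul_neg, inv_mul_cancel₀ (pow_ne_zero ν hq0), one_smul,
        mul_assoc, ← mul_assoc x, hxg, smul_mul_assoc, mul_smul_comm, two_mul, pow_add]
      simp only [mul_assoc]
    have e2 : (-(q ^ ν) • (b ^ ν * y)) * (-(q ^ ν)⁻¹ • (b ^ ν * x))
        = q ^ ν • (b ^ (2 * ν) * (y * x)) := by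
      rw [smul_mul_smul_comm, neg_mul_neg, mul_inv_cancel₀ (pow_ne_zero ν hq0), one_smul,
        mul_assoc, ← mul_assoc y, hyg, smul_mul_assoc, mul_smul_comm, two_mul, pow_add]
      simp only [mul_assoc]
    rw [← MulOpposite.op_mul, ← MulOpposite.op_mul, ← MulOpposite.op_smul, e1, e2, smul_smul,
      inv_mul_cancel₀ (pow_ne_zero ν hq0), one_smul, ← MulOpposite.op_sub, ← mul_smul_comm,
      ← mul_sub, ← neg_sub (y * x), mul_neg, h.y_x, key]
    rfl

namespace U

section Hopf

variable {k : Type u} [Field k] (n N ν : ℕ) (q α β γ : k) [Admissible n N ν q]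

/-- `Δ(a) = a ⊗ a`, `Δ(x) = x ⊗ a^ν + 1 ⊗ x`, `Δ(y) = y ⊗ a^ν + 1 ⊗ y`. -/
noncomputable def comulHom :
    U n N ν q α β γ →ₐ[k] U n N ν q α β γ ⊗[k] U n N ν q α β γ :=
  lift (relations n N ν q α β γ).tensor

/-- `ε(a) = 1`, `ε(x) = 0`, `ε(y) = 0`. -/
noncomputable def counitHom : U n N ν q α β γ →ₐ[k] k :=
  lift (a' := (1 : k)) (x' := 0) (y' := 0) Relations.counit

/-- `s(a) = a⁻¹`, `s(x) = -q^(-ν) a^(-ν) x`, `s(y) = -q^ν a^(-ν) y`, extended to an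
antihomomorphism. Here `a⁻¹ = a^(N-1)`. -/
noncomputable def antipodeHom : U n N ν q α β γ →ₐ[k] (U n N ν q α β γ)ᵐᵒᵖ :=
  lift (relations n N ν q α β γ).antipode

noncomputable instance : Bialgebra k (U n N ν q α β γ) :=
  Bialgebra.ofAlgHom (comulHom n N ν q α β γ) (counitHom n N ν q α β γ)
    (by
      apply algHom_ext <;>
        simp [comulHom, TensorProduct.add_tmul, TensorProduct.tmul_add,
          Algebra.TensorProduct.one_def, add_assoc])
    (by
      apply algHom_ext <;>
        simp [comulHom, counitHom])
    (by
      apply algHom_ext <;>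
        simp [comulHom, counitHom])

/-- The antipode as a linear map. -/
noncomputable def antipodeLin : U n N ν q α β γ →ₗ[k] U n N ν q α β γ :=
  (MulOpposite.opLinearEquiv k).symm.toLinearMap ∘ₗ (antipodeHom n N ν q α β γ).toLinearMap

theorem comul_def (z : U n N ν q α β γ) :
    Coalgebra.comul (R := k) z = comulHom n N ν q α β γ z := rfl

theorem counit_def (z : U n N ν q α β γ) :
    Coalgebra.counit (R := k) z = counitHom n N ν q α β γ z := rfl

theorem antipodeLin_mul (z w : U n N ν q α β γ) :
    antipodeLin n N ν q α β γ (z * w)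
      = antipodeLin n N ν q α β γ w * antipodeLin n N ν q α β γ z := by
  simp [antipodeLin]

theorem antipodeLin_one : antipodeLin n N ν q α β γ 1 = 1 := by
  simp [antipodeLin]

theorem antipodeLin_a :
    antipodeLin n N ν q α β γ (a n N ν q α β γ) = a n N ν q α β γ ^ (N - 1) := by
  simp [antipodeLin, antipodeHom]

theorem antipodeLin_x :
    antipodeLin n N ν q α β γ (x n N ν q α β γ)
      = -(q ^ ν)⁻¹ • ((a n N ν q α β γ ^ (N - 1)) ^ ν * x n N ν q α β γ) := by
  simp [antipodeLin, antipodeHom]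

theorem antipodeLin_y :
    antipodeLin n N ν q α β γ (y n N ν q α β γ)
      = -(q ^ ν) • ((a n N ν q α β γ ^ (N - 1)) ^ ν * y n N ν q α β γ) := by
  simp [antipodeLin, antipodeHom]

theorem a_inv_mul (m : ℕ) :
    (a n N ν q α β γ ^ (N - 1)) ^ m * a n N ν q α β γ ^ m = 1 := by
  have hN : 0 < N := lt_of_le_of_lt (Nat.zero_le ν) (Admissible.lt n q)
  rw [← pow_mul, ← pow_add, ← Nat.succ_mul, Nat.succ_eq_add_one, Nat.sub_add_cancel hN, pow_mul,
    (relations n N ν q α β γ).a_pow, one_pow]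

theorem a_mul_inv (m : ℕ) :
    a n N ν q α β γ ^ m * (a n N ν q α β γ ^ (N - 1)) ^ m = 1 := by
  rw [← pow_mul, ← pow_add, add_comm, pow_add, pow_mul, a_inv_mul]

/-- `Σ s(z₁) z₂` and `Σ z₁ s(z₂)`, on the tensor square. -/
theorem antipode_left_mul (t w : U n N ν q α β γ ⊗[k] U n N ν q α β γ) (r : k)
    (ht : LinearMap.mul' k _ ((antipodeLin n N ν q α β γ).rTensor _ t) = algebraMap k _ r) :
    LinearMap.mul' k _ ((antipodeLin n N ν q α β γ).rTensor _ (t * w))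
      = r • LinearMap.mul' k _ ((antipodeLin n N ν q α β γ).rTensor _ w) := by
  induction w with
  | zero => simp
  | add w₁ w₂ h₁ h₂ => rw [mul_add, map_add, map_add, h₁, h₂, map_add, map_add, smul_add]
  | tmul u v =>
    have aux : ∀ t : U n N ν q α β γ ⊗[k] U n N ν q α β γ,
        LinearMap.mul' k _ ((antipodeLin n N ν q α β γ).rTensor _ (t * u ⊗ₜ[k] v))
          = antipodeLin n N ν q α β γ u
            * LinearMap.mul' k _ ((antipodeLin n N ν q α β γ).rTensor _ t) * v := by
      intro t
      induction t with
      | zero => simp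
      | add t₁ t₂ h₁ h₂ => rw [add_mul, map_add, map_add, h₁, h₂, map_add, map_add, mul_add, add_mul]
      | tmul u' v' => simp [antipodeLin_mul, mul_assoc]
    rw [aux, ht, ← Algebra.commutes, mul_assoc, ← Algebra.smul_def]
    simp

theorem antipode_right_mul (t w : U n N ν q α β γ ⊗[k] U n N ν q α β γ) (r : k)
    (hw : LinearMap.mul' k _ ((antipodeLin n N ν q α β γ).lTensor _ w) = algebraMap k _ r) :
    LinearMap.mul' k _ ((antipodeLin n N ν q α β γ).lTensor _ (t * w))
      = r • LinearMap.mul' k _ ((antipodeLin n N ν q α β γ).lTensor _ t) := by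
  induction t with
  | zero => simp
  | add t₁ t₂ h₁ h₂ => rw [add_mul, map_add, map_add, h₁, h₂, map_add, map_add, smul_add]
  | tmul u v =>
    have aux : ∀ w : U n N ν q α β γ ⊗[k] U n N ν q α β γ,
        LinearMap.mul' k _ ((antipodeLin n N ν q α β γ).lTensor _ (u ⊗ₜ[k] v * w))
          = u * LinearMap.mul' k _ ((antipodeLin n N ν q α β γ).lTensor _ w)
            * antipodeLin n N ν q α β γ v := by
      intro w
      induction w with
      | zero => simp
      | add w₁ w₂ h₁ h₂ => rw [mul_add, map_add, map_add, h₁, h₂, map_add, map_add, mul_add, add_mul]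
      | tmul u' v' => simp [antipodeLin_mul, mul_assoc]
    rw [aux, hw, ← Algebra.commutes, mul_assoc, ← Algebra.smul_def]
    simp

theorem antipode_left (z : U n N ν q α β γ) :
    LinearMap.mul' k _ ((antipodeLin n N ν q α β γ).rTensor _ (comulHom n N ν q α β γ z))
      = algebraMap k _ (counitHom n N ν q α β γ z) := by
  have hq0 : q ≠ 0 := (Admissible.primitive N ν : IsPrimitiveRoot q n).ne_zero
    (lt_trans one_pos (Admissible.one_lt N ν q)).ne'
  have hR := relations n N ν q α β γ
  induction z using U.induction with
  | hk r => simp [Algebra.TensorProduct.one_def, Algebra.algebraMap_eq_smul_one,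
      antipodeLin_one]
  | ha => simpa [comulHom, counitHom, antipodeLin_a] using a_inv_mul n N ν q α β γ 1
  | hx =>
    simp [comulHom, counitHom, antipodeLin_x, antipodeLin_one, mul_assoc, mul_pow_comm hR.x_a ν,
      smul_smul, inv_mul_cancel₀ (pow_ne_zero ν hq0)]
    simp [← mul_assoc, a_inv_mul]
  | hy =>
    simp [comulHom, counitHom, antipodeLin_y, antipodeLin_one, mul_assoc, mul_pow_comm hR.y_a ν,
      smul_smul, mul_inv_cancel₀ (pow_ne_zero ν hq0)]
    simp [← mul_assoc, a_inv_mul]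
  | hmul z w hz hw =>
    rw [map_mul, antipode_left_mul _ _ _ _ _ _ _ _ _ _ hz, hw, map_mul, map_mul, Algebra.smul_def]
  | hadd z w hz hw => rw [map_add, map_add, map_add, hz, hw, map_add, map_add]

theorem antipode_right (z : U n N ν q α β γ) :
    LinearMap.mul' k _ ((antipodeLin n N ν q α β γ).lTensor _ (comulHom n N ν q α β γ z))
      = algebraMap k _ (counitHom n N ν q α β γ z) := by
  have hq0 : q ≠ 0 := (Admissible.primitive N ν : IsPrimitiveRoot q n).ne_zero
    (lt_trans one_pos (Admissible.one_lt N ν q)).ne'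
  have hR := relations n N ν q α β γ
  have hinv : antipodeLin n N ν q α β γ (a n N ν q α β γ ^ ν)
      = (a n N ν q α β γ ^ (N - 1)) ^ ν := by
    simp [antipodeLin, antipodeHom]
  have hcancel : ∀ (z : U n N ν q α β γ) (c : k), c ≠ 0 →
      z * a n N ν q α β γ ^ ν = c • (a n N ν q α β γ ^ ν * z) →
      z * (a n N ν q α β γ ^ (N - 1)) ^ ν = c⁻¹ • ((a n N ν q α β γ ^ (N - 1)) ^ ν * z) := by
    intro z c hc h
    calc z * (a n N ν q α β γ ^ (N - 1)) ^ ν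
        = c⁻¹ • ((a n N ν q α β γ ^ (N - 1)) ^ ν * (c • (a n N ν q α β γ ^ ν * z))
            * (a n N ν q α β γ ^ (N - 1)) ^ ν) := by
          rw [mul_smul_comm, smul_mul_assoc, smul_smul, inv_mul_cancel₀ hc, one_smul,
            ← mul_assoc, a_inv_mul, one_mul]
      _ = c⁻¹ • ((a n N ν q α β γ ^ (N - 1)) ^ ν * z) := by
          rw [← h, ← mul_assoc, mul_assoc, a_mul_inv, mul_one]
  induction z using U.induction with
  | hk r => simp [Algebra.TensorProduct.one_def, Algebra.algebraMap_eq_smul_one,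
      antipodeLin_one]
  | ha => simpa [comulHom, counitHom, antipodeLin_a] using a_mul_inv n N ν q α β γ 1
  | hx =>
    have := hcancel _ _ (pow_ne_zero ν hq0) (mul_pow_comm hR.x_a ν)
    simp [comulHom, counitHom, antipodeLin_x, hinv, this]
  | hy =>
    have := hcancel _ _ (pow_ne_zero ν (inv_ne_zero hq0)) (mul_pow_comm hR.y_a ν)
    simp [comulHom, counitHom, antipodeLin_y, hinv, this]
  | hmul z w hz hw =>
    rw [map_mul, antipode_right_mul _ _ _ _ _ _ _ _ _ _ hw, hz, map_mul, map_mul,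
      Algebra.smul_def, Algebra.commutes]
  | hadd z w hz hw => rw [map_add, map_add, map_add, hz, hw, map_add, map_add]

/-- The Hopf algebra `U_(n,N,ν,q,α,β,γ)`. -/
noncomputable instance : HopfAlgebra k (U n N ν q α β γ) where
  antipode := antipodeLin n N ν q α β γ
  mul_antipode_rTensor_comul := LinearMap.ext fun z => antipode_left n N ν q α β γ z
  mul_antipode_lTensor_comul := LinearMap.ext fun z => antipode_right n N ν q α β γ z

end Hopf

end U

/-! ### Kaplansky's tenth conjecture -/

/-- Up to isomorphism, there are only finitely many Hopf algebras of dimension `d` over `k`: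
some finite list of Hopf algebras represents all of them. -/
def FinitelyManyHopfAlgebras (k : Type u) [Field k] (d : ℕ) : Prop :=
  ∃ (m : ℕ) (H : Fin m → HopfAlgCat.{u} k),
    ∀ (A : Type u) [Ring A] [HopfAlgebra k A], Module.Finite k A → Module.finrank k A = d →
      ∃ i, Nonempty (A ≃ₐc[k] H i)

/-- Kaplansky's tenth conjecture over `k`: in every dimension there are only finitely many
Hopf algebras up to isomorphism. -/
def KaplanskyTenthConjecture (k : Type u) [Field k] : Prop :=
  ∀ d : ℕ, FinitelyManyHopfAlgebras k d

end GelakiHopf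

/-!
The algebra `U = U_(n,N,ν,q,α,β,γ)` has the basis of reduced monomials `aⁱ xʲ yˡ`, with `i < N` and
`j, l < n`. They span because the relations straighten any word (`Relations.monomial_mem`,
`U.monomialSpan_eq_top`). For their independence, suppose that `U` has this basis: then a functional
`φ` on `U` is determined by the function `f i j l = φ (aⁱ xʲ yˡ)`, which obeys recurrences in each
variable, and the right action of `U` on functionals becomes explicit operators on such functions.
These operators are taken as the definition of a `U`-module; the relations hold on it
(`relations_act`), the one for `yⁿ` because `yⁿ` commutes with `a` and `x`. Indicator functions then
provide functionals `coord i j l` on `U` which are dual to the reduced monomials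
(`coord_monomial`), and the dimension is `N n²`.

The `q`-binomial formula expresses the comultiplication in these coordinates
(`coordTensor_comul`). It is graded by the degrees in `x` and `y`, and the `q`-integers which arise
when a single `x` or `y` is split off are nonzero, being those of `1, …, n - 1`
(`gaussCoeff_one_ne_zero`). Comparing coordinates shows that the group-like elements are the powers
of `a` (`eq_a_pow_of_comul_eq_tmul_self`), and that an element `z` with `Δ z = z ⊗ aᵐ + 1 ⊗ z` is a
combination of `x` and `y` plus an element of `k⟨a⟩`, where `x` and `y` do not occur if `aᵐ ≠ a^ν`
(`exists_eq_of_skewPrimitive`).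

Let `e : U_(α,β,γ) ≃ U_(α',β',γ')` be an isomorphism. Then `e a = aʳ`, and `e x`, `e y` are
skew-primitive with respect to `a^(rν)`, nonzero, and scaled by `q^(±1)` under `aʳ`. Hence
`rν ≡ ν` modulo `N`, so that `qʳ = q`, and as `q ≠ q⁻¹` for `n > 2`, `e x = s x` and `e y = t y`.
The relations now give `α = sⁿ α'`, `β = tⁿ β'`, `γ = s t γ'` (`exists_scalars_of_bialgEquiv`),
because `a^(νn) ≠ 1` and `a^(2ν) ≠ 1`. So `αβ/γⁿ` is an invariant, and the algebras with parameters
`(α, 1, 1)` are pairwise non-isomorphic; over an infinite field no finite list contains them all.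
-/

namespace GelakiHopf

/-! ### Consequences of admissibility -/

section Admissible

variable {k : Type u} [Field k] {n N ν : ℕ} {q : k}

theorem Admissible.n_pos (h : Admissible n N ν q) : 0 < n := lt_trans one_pos h.one_lt

theorem Admissible.N_pos (h : Admissible n N ν q) : 0 < N := lt_of_le_of_lt (Nat.zero_le ν) h.lt

theorem Admissible.q_ne_zero (h : Admissible n N ν q) : q ≠ 0 := h.primitive.ne_zero h.n_pos.ne'

theorem Admissible.primitive_pow (h : Admissible n N ν q) : IsPrimitiveRoot (q ^ ν) n :=
  h.primitive.pow_of_coprime ν h.coprime.symm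

theorem Admissible.pow_N (h : Admissible n N ν q) : q ^ N = 1 :=
  (h.primitive.pow_eq_one_iff_dvd N).mpr h.dvd

theorem Admissible.pow_mul_n (h : Admissible n N ν q) : q ^ (ν * n) = 1 := by
  rw [mul_comm, pow_mul, h.primitive.pow_eq_one, one_pow]

end Admissible

/-! ### Powers of `y` and spanning monomials -/

section Algebra

variable {k : Type u} [Field k] {n N ν : ℕ} {q α β γ : k} {A : Type*} [Ring A] [Algebra k A]

theorem geom_sum_add_of_primitiveRoot {ω : k} (hn : 1 < n) (hω : IsPrimitiveRoot ω n) (j : ℕ) :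
    ∑ m ∈ Finset.range (j + n), ω ^ m = ∑ m ∈ Finset.range j, ω ^ m := by
  rw [Finset.sum_range_add]
  simp only [pow_add, ← Finset.mul_sum]
  rw [hω.geom_sum_eq_zero hn, mul_zero, add_zero]

/-- Moving a power of `y` past `x` when `yx - ω⁻¹xy` is a multiple of `g - 1`. The error term
carries a `q`-integer, which vanishes at a root of unity. -/
theorem pow_succ_mul_of_skew_commutator {ω : k} {x y g : A} {γ : k}
    (hyg : y * g = (ω⁻¹ ^ 2) • (g * y)) (hyx : y * x - ω⁻¹ • (x * y) = γ • (g - 1)) (m : ℕ) :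
    y ^ (m + 1) * x = ω⁻¹ ^ (m + 1) • (x * y ^ (m + 1)) +
      (γ * ∑ i ∈ Finset.range (m + 1), ω⁻¹ ^ i) • ((ω⁻¹ ^ m • g - 1) * y ^ m) := by
  have e : y * x = ω⁻¹ • (x * y) + γ • (g - 1) := by rw [← hyx]; abel
  induction m with
  | zero => simp [e]
  | succ m ih =>
    have hs : ∑ i ∈ Finset.range (m + 2), ω⁻¹ ^ i
        = 1 + ω⁻¹ * ∑ i ∈ Finset.range (m + 1), ω⁻¹ ^ i := by
      rw [Finset.sum_range_succ', Finset.mul_sum]; simp [pow_succ', add_comm]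
    have hs' := Finset.sum_range_succ (fun i => ω⁻¹ ^ i) (m + 1)
    have h1 : y * (x * y ^ (m + 1)) =
        ω⁻¹ • (x * y ^ (m + 2)) + γ • (g * y ^ (m + 1) - y ^ (m + 1)) := by
      rw [← mul_assoc, e, add_mul, smul_mul_assoc, smul_mul_assoc, sub_mul, mul_assoc, ← pow_succ',
        one_mul]
    have h2 : y * ((ω⁻¹ ^ m • g - 1) * y ^ m)
        = ω⁻¹ ^ (m + 2) • (g * y ^ (m + 1)) - y ^ (m + 1) := by
      rw [sub_mul, mul_sub, one_mul, smul_mul_assoc, mul_smul_comm, ← mul_assoc, hyg,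
        smul_mul_assoc, smul_smul, mul_assoc, ← pow_succ', ← pow_add]
    rw [pow_succ' y (m + 1), mul_assoc, ih, mul_add, mul_smul_comm, mul_smul_comm, h1, h2, sub_mul,
      one_mul, smul_mul_assoc, ← pow_succ' y (m + 1)]
    generalize (∑ i ∈ Finset.range (m + 1), ω⁻¹ ^ i) = S at *
    have hs3 : 1 + ω⁻¹ * S = S + ω⁻¹ ^ (m + 1) := by rw [← hs, hs']
    rw [hs]
    simp only [smul_add, smul_sub, smul_smul]
    have c1 : ω⁻¹ ^ (m + 1) * γ + γ * S * ω⁻¹ ^ (m + 2)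
        = γ * (1 + ω⁻¹ * S) * ω⁻¹ ^ (m + 1) := by ring
    have c2 : ω⁻¹ ^ (m + 1) * γ + γ * S = γ * (1 + ω⁻¹ * S) := by rw [hs3]; ring
    have c3 : ω⁻¹ ^ (m + 1) * ω⁻¹ = ω⁻¹ ^ (m + 1 + 1) := by ring
    rw [← c1, ← c2, c3, add_smul, add_smul]
    abel

/-- If `ω` is a primitive `n`-th root of unity then `yⁿ` commutes with `x`. -/
theorem commute_pow_of_skew_commutator (hn : 1 < n) {ω : k} (hω : IsPrimitiveRoot ω n)
    {x y g : A} {γ : k} (hyg : y * g = (ω⁻¹ ^ 2) • (g * y))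
    (hyx : y * x - ω⁻¹ • (x * y) = γ • (g - 1)) : Commute (y ^ n) x := by
  obtain ⟨m, rfl⟩ : ∃ m, n = m + 1 := ⟨n - 1, by omega⟩
  have := pow_succ_mul_of_skew_commutator hyg hyx m
  rw [hω.inv.geom_sum_eq_zero hn, hω.inv.pow_eq_one] at this
  simpa [Commute, SemiconjBy] using this

/-- The span of the monomials `aⁱ xʲ yˡ` with `i < N` and `j, l < n`. -/
def monomialSpan (k : Type u) [Field k] (n N : ℕ) {A : Type*} [Ring A] [Algebra k A] (a x y : A) :
    Submodule k A :=
  Submodule.span k (Set.range fun p : Fin N × Fin n × Fin n =>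
    a ^ (p.1 : ℕ) * x ^ (p.2.1 : ℕ) * y ^ (p.2.2 : ℕ))

variable {a x y : A}

theorem Relations.commute_a_pow_x (h : Relations n N ν q α β γ a x y) (hq : q ^ n = 1) :
    Commute (a ^ (ν * n)) x := by
  have := mul_pow_comm h.x_a (ν * n)
  rw [mul_comm ν n, pow_mul q, hq, one_pow, one_smul] at this
  rw [mul_comm ν n]
  exact this.symm

theorem Relations.monomial_mem (h : Relations n N ν q α β γ a x y) (hN : 0 < N) (hn : 0 < n)
    (hq : q ^ n = 1) (i j l : ℕ) : a ^ i * x ^ j * y ^ l ∈ monomialSpan k n N a x y := by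
  induction j using Nat.strong_induction_on generalizing i l with
  | _ j ihj =>
  rcases lt_or_ge j n with hj | hj
  · induction l using Nat.strong_induction_on generalizing i with
    | _ l ihl =>
    rcases lt_or_ge l n with hl | hl
    · refine Submodule.subset_span ⟨(⟨i % N, Nat.mod_lt _ hN⟩, ⟨j, hj⟩, ⟨l, hl⟩), ?_⟩
      simp only
      rw [← pow_mod_orderOf a (i % N), Nat.mod_mod_of_dvd _ (orderOf_dvd_of_pow_eq_one h.a_pow),
        pow_mod_orderOf]
    · obtain ⟨l, rfl⟩ := Nat.exists_eq_add_of_le hl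
      have e : a ^ i * x ^ j * y ^ (n + l)
          = β • (a ^ (i + ν * n) * x ^ j * y ^ l - a ^ i * x ^ j * y ^ l) := by
        have hc := (h.commute_a_pow_x hq).pow_right j
        rw [pow_add y, h.y_pow, smul_mul_assoc, mul_smul_comm, sub_mul, one_mul, mul_sub,
          pow_add a, mul_assoc (a ^ i), ← mul_assoc (x ^ j), ← hc.eq]
        simp only [mul_assoc]
      rw [e]
      exact Submodule.smul_mem _ _ (Submodule.sub_mem _ (ihl l (by omega) _) (ihl l (by omega) _))
  · obtain ⟨j, rfl⟩ := Nat.exists_eq_add_of_le hj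
    have e : a ^ i * x ^ (n + j) * y ^ l
        = α • (a ^ (i + ν * n) * x ^ j * y ^ l - a ^ i * x ^ j * y ^ l) := by
      rw [pow_add x, h.x_pow, smul_mul_assoc, mul_smul_comm, smul_mul_assoc, sub_mul, one_mul,
        mul_sub, pow_add a, sub_mul]
      simp only [mul_assoc]
    rw [e]
    exact Submodule.smul_mem _ _
      (Submodule.sub_mem _ (ihj j (by omega) _ _) (ihj j (by omega) _ _))

theorem mul_mem_of_monomials {z : A} (M : Submodule k A)
    (hz : ∀ i j l : ℕ, z * (a ^ i * x ^ j * y ^ l) ∈ M) {w : A}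
    (hw : w ∈ monomialSpan k n N a x y) : z * w ∈ M := by
  induction hw using Submodule.span_induction with
  | mem w hw => obtain ⟨p, rfl⟩ := hw; exact hz _ _ _
  | zero => simp
  | add v w _ _ hv hw => rw [mul_add]; exact M.add_mem hv hw
  | smul c w _ hw => rw [mul_smul_comm]; exact M.smul_mem c hw

theorem Relations.a_mul_mem (h : Relations n N ν q α β γ a x y) (hN : 0 < N) (hn : 0 < n)
    (hq : q ^ n = 1) {w : A} (hw : w ∈ monomialSpan k n N a x y) :
    a * w ∈ monomialSpan k n N a x y := by
  refine mul_mem_of_monomials _ (fun i j l => ?_) hw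
  rw [← mul_assoc, ← mul_assoc, ← pow_succ']
  exact h.monomial_mem hN hn hq _ _ _

theorem Relations.x_mul_mem (h : Relations n N ν q α β γ a x y) (hN : 0 < N) (hn : 0 < n)
    (hq : q ^ n = 1) {w : A} (hw : w ∈ monomialSpan k n N a x y) :
    x * w ∈ monomialSpan k n N a x y := by
  refine mul_mem_of_monomials _ (fun i j l => ?_) hw
  rw [← mul_assoc, ← mul_assoc, mul_pow_comm h.x_a, smul_mul_assoc, smul_mul_assoc, mul_assoc _ x,
    ← pow_succ']
  exact Submodule.smul_mem _ _ (h.monomial_mem hN hn hq _ _ _)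

theorem Relations.y_mul_mem (h : Relations n N ν q α β γ a x y) (hN : 0 < N) (hn : 0 < n)
    (hq : q ^ n = 1) {w : A} (hw : w ∈ monomialSpan k n N a x y) :
    y * w ∈ monomialSpan k n N a x y := by
  refine mul_mem_of_monomials _ (fun i j l => ?_) hw
  have e : y * x = (q ^ ν)⁻¹ • (x * y) + γ • (a ^ (2 * ν) - 1) := by rw [← h.y_x]; abel
  induction j generalizing i l with
  | zero =>
    rw [pow_zero, mul_one, ← mul_assoc, mul_pow_comm h.y_a, smul_mul_assoc, mul_assoc,
      ← pow_succ']
    simpa using Submodule.smul_mem _ (q⁻¹ ^ i) (h.monomial_mem hN hn hq i 0 (l + 1))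
  | succ j ih =>
    -- Moving `y` past `aⁱ x` leaves `x` times a shorter instance, plus multiples of monomials.
    have e2 : y * (a ^ i * x ^ (j + 1) * y ^ l)
        = q⁻¹ ^ i • (a ^ i * ((q ^ ν)⁻¹ • (x * (y * (a ^ 0 * x ^ j * y ^ l)))
          + γ • (a ^ (2 * ν) * x ^ j * y ^ l - a ^ 0 * x ^ j * y ^ l))) := by
      rw [← mul_assoc, ← mul_assoc, mul_pow_comm h.y_a, pow_succ' x, pow_zero, one_mul,
        smul_mul_assoc, smul_mul_assoc, mul_assoc, mul_assoc, ← mul_assoc y,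
        ← mul_assoc y, e, add_mul, add_mul]
      simp only [smul_mul_assoc, sub_mul, one_mul, mul_assoc]
    have ha : ∀ (m : ℕ) {v : A}, v ∈ monomialSpan k n N a x y →
        a ^ m * v ∈ monomialSpan k n N a x y := by
      intro m v hv
      induction m with
      | zero => simpa using hv
      | succ m ihm =>
        rw [pow_succ', mul_assoc]
        exact h.a_mul_mem hN hn hq ihm
    rw [e2]
    refine Submodule.smul_mem _ _ (ha i (Submodule.add_mem _ (Submodule.smul_mem _ _
      (h.x_mul_mem hN hn hq (ih 0 l))) (Submodule.smul_mem _ _ (Submodule.sub_mem _ ?_ ?_))))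
    · exact h.monomial_mem hN hn hq _ _ _
    · exact h.monomial_mem hN hn hq _ _ _

end Algebra

section Spanning

variable {k : Type u} [Field k] {n N ν : ℕ} {q α β γ : k}

theorem U.monomialSpan_eq_top (hN : 0 < N) (hn : 0 < n) (hq : q ^ n = 1) :
    monomialSpan k n N (U.a n N ν q α β γ) (U.x n N ν q α β γ) (U.y n N ν q α β γ) = ⊤ := by
  have h := U.relations n N ν q α β γ
  suffices H : ∀ z w : U n N ν q α β γ,
      w ∈ monomialSpan k n N (U.a n N ν q α β γ) (U.x n N ν q α β γ) (U.y n N ν q α β γ) →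
      z * w ∈ monomialSpan k n N (U.a n N ν q α β γ) (U.x n N ν q α β γ) (U.y n N ν q α β γ) by
    refine Submodule.eq_top_iff'.mpr fun z => ?_
    simpa using H z 1 (by simpa using h.monomial_mem hN hn hq 0 0 0)
  intro z
  induction z using U.induction with
  | hk r => intro w hw; rw [← Algebra.smul_def]; exact Submodule.smul_mem _ _ hw
  | ha => exact fun w hw => h.a_mul_mem hN hn hq hw
  | hx => exact fun w hw => h.x_mul_mem hN hn hq hw
  | hy => exact fun w hw => h.y_mul_mem hN hn hq hw
  | hmul z z' hz hz' => intro w hw; rw [mul_assoc]; exact hz _ (hz' _ hw)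
  | hadd z z' hz hz' => intro w hw; rw [add_mul]; exact Submodule.add_mem _ (hz _ hw) (hz' _ hw)

end Spanning

/-! ### A module of functions and the coordinate functionals -/

section Model

variable {k : Type u} [Field k] (n N ν : ℕ) (q α β γ : k)

/-- The functions `f i j l` on `ℕ³` which transform like the values `φ (aⁱ xʲ yˡ)` of a linear
functional `φ` on `U_(n,N,ν,q,α,β,γ)` when `i`, `j`, `l` are reduced by means of the relations
for `a^N`, `x^n` and `y^n`. -/
def monomialFunctions : Submodule k (ℕ → ℕ → ℕ → k) where
  carrier := {f | (∀ i j l, f (i + N) j l = f i j l) ∧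
    (∀ i j l, f i (j + n) l = α * (f (i + ν * n) j l - f i j l)) ∧
    (∀ i j l, f i j (l + n) = β * (f (i + ν * n) j l - f i j l))}
  add_mem' := by
    rintro f g ⟨f1, f2, f3⟩ ⟨g1, g2, g3⟩
    refine ⟨fun i j l => ?_, fun i j l => ?_, fun i j l => ?_⟩
    · simp only [Pi.add_apply, f1, g1]
    · simp only [Pi.add_apply, f2, g2]; ring
    · simp only [Pi.add_apply, f3, g3]; ring
  zero_mem' := by simp
  smul_mem' := by
    rintro c f ⟨f1, f2, f3⟩
    refine ⟨fun i j l => ?_, fun i j l => ?_, fun i j l => ?_⟩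
    · simp only [Pi.smul_apply, smul_eq_mul, f1]
    · simp only [Pi.smul_apply, smul_eq_mul, f2]; ring
    · simp only [Pi.smul_apply, smul_eq_mul, f3]; ring

/-- On functions `f i j l = φ (aⁱ xʲ yˡ)`, the operator which replaces `φ` by `φ (a ·)`. -/
def shiftA : Module.End k (ℕ → ℕ → ℕ → k) where
  toFun f i j l := f (i + 1) j l
  map_add' _ _ := rfl
  map_smul' _ _ := rfl

/-- On functions `f i j l = φ (aⁱ xʲ yˡ)`, the operator which replaces `φ` by `φ (x ·)`. -/
def shiftX : Module.End k (ℕ → ℕ → ℕ → k) where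
  toFun f i j l := q ^ i * f i (j + 1) l
  map_add' f g := by ext; simp [mul_add]
  map_smul' c f := by ext; simp [mul_left_comm]

/-- On functions `f i j l = φ (aⁱ xʲ yˡ)`, the operator which replaces `φ` by `φ (y ·)`. It is
obtained by moving `y` to the right past `aⁱ xʲ`; for `j = 0` the terms which contain the truncated
`j - 1` have coefficient `0`. -/
def shiftY : Module.End k (ℕ → ℕ → ℕ → k) where
  toFun f i j l := q⁻¹ ^ i * ((q ^ ν)⁻¹ ^ j * f i j (l + 1) +
    γ * ((∑ m ∈ Finset.range j, (q ^ ν) ^ m) * f (i + 2 * ν) (j - 1) l -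
      (∑ m ∈ Finset.range j, (q ^ ν)⁻¹ ^ m) * f i (j - 1) l))
  map_add' f g := by ext; simp only [Pi.add_apply]; ring
  map_smul' c f := by ext; simp only [Pi.smul_apply, smul_eq_mul, RingHom.id_apply]; ring

theorem shiftA_apply (f : ℕ → ℕ → ℕ → k) (i j l : ℕ) : shiftA f i j l = f (i + 1) j l := rfl

theorem shiftX_apply (f : ℕ → ℕ → ℕ → k) (i j l : ℕ) :
    shiftX q f i j l = q ^ i * f i (j + 1) l := rfl

theorem shiftY_apply (f : ℕ → ℕ → ℕ → k) (i j l : ℕ) :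
    shiftY ν q γ f i j l = q⁻¹ ^ i * ((q ^ ν)⁻¹ ^ j * f i j (l + 1) +
    γ * ((∑ m ∈ Finset.range j, (q ^ ν) ^ m) * f (i + 2 * ν) (j - 1) l -
      (∑ m ∈ Finset.range j, (q ^ ν)⁻¹ ^ m) * f i (j - 1) l)) := rfl

theorem shiftA_mem {f : ℕ → ℕ → ℕ → k} (hf : f ∈ monomialFunctions n N ν α β) :
    shiftA f ∈ monomialFunctions n N ν α β := by
  obtain ⟨h1, h2, h3⟩ := hf
  refine ⟨fun i j l => ?_, fun i j l => ?_, fun i j l => ?_⟩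
  · simp only [shiftA_apply, add_right_comm i N, h1]
  · simp only [shiftA_apply, h2, add_right_comm i _ 1]
  · simp only [shiftA_apply, h3, add_right_comm i _ 1]

/-- The operator `shiftA` on `monomialFunctions`. -/
def actA : Module.End k (monomialFunctions n N ν α β) :=
  (shiftA (k := k)).restrict fun _ hf => shiftA_mem n N ν α β hf

theorem actA_pow_apply (f : monomialFunctions n N ν α β) (i j l m : ℕ) :
    (((actA n N ν α β) ^ m) f).1 i j l = f.1 (i + m) j l := by
  induction m generalizing i with
  | zero => simp
  | succ m ih =>
    rw [pow_succ', Module.End.mul_apply]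
    exact (ih (i + 1)).trans (by rw [add_right_comm, add_assoc])

variable [h : Admissible n N ν q]

theorem shiftX_mem {f : ℕ → ℕ → ℕ → k} (hf : f ∈ monomialFunctions n N ν α β) :
    shiftX q f ∈ monomialFunctions n N ν α β := by
  obtain ⟨h1, h2, h3⟩ := hf
  have e1 : q ^ N = 1 := h.pow_N
  have e2 : q ^ (ν * n) = 1 := h.pow_mul_n
  refine ⟨fun i j l => ?_, fun i j l => ?_, fun i j l => ?_⟩
  · simp only [shiftX_apply, h1, pow_add, e1, mul_one]
  · simp only [shiftX_apply, add_right_comm j n 1, h2, pow_add, e2, mul_one]; ring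
  · simp only [shiftX_apply, h3, pow_add, e2, mul_one]; ring

theorem shiftY_mem {f : ℕ → ℕ → ℕ → k} (hf : f ∈ monomialFunctions n N ν α β) :
    shiftY ν q γ f ∈ monomialFunctions n N ν α β := by
  obtain ⟨h1, h2, h3⟩ := hf
  have hn : 1 < n := h.one_lt
  have hω : IsPrimitiveRoot (q ^ ν) n := h.primitive_pow
  have e1 : q⁻¹ ^ N = 1 := by rw [inv_pow, h.pow_N, inv_one]
  have e2 : q⁻¹ ^ (ν * n) = 1 := by
    rw [inv_pow, h.pow_mul_n, inv_one]
  refine ⟨fun i j l => ?_, fun i j l => ?_, fun i j l => ?_⟩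
  · simp only [shiftY_apply, h1, pow_add, e1, mul_one, add_right_comm i N]
  · simp only [shiftY_apply, geom_sum_add_of_primitiveRoot hn hω,
      geom_sum_add_of_primitiveRoot hn hω.inv]
    rw [pow_add _ j n, hω.inv.pow_eq_one, pow_add _ i (ν * n), e2, h2]
    rcases j with _ | j
    · simp; ring
    · rw [Nat.add_sub_cancel, add_right_comm j 1 n, Nat.add_sub_cancel, h2, h2,
        add_right_comm i (2 * ν)]
      ring
  · simp only [shiftY_apply]
    rw [add_right_comm l n 1, h3, h3, h3, pow_add _ i (ν * n), e2, add_right_comm i (2 * ν)]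
    ring

/-- The operator `shiftX` on `monomialFunctions`. -/
def actX : Module.End k (monomialFunctions n N ν α β) :=
  (shiftX q).restrict fun _ hf => shiftX_mem n N ν q α β hf

/-- The operator `shiftY` on `monomialFunctions`. -/
def actY : Module.End k (monomialFunctions n N ν α β) :=
  (shiftY ν q γ).restrict fun _ hf => shiftY_mem n N ν q α β γ hf

section Powers

variable (f : monomialFunctions n N ν α β) (i j l : ℕ)

theorem actX_pow_apply (m : ℕ) :
    (((actX n N ν q α β) ^ m) f).1 i j l = (q ^ m) ^ i * f.1 i (j + m) l := by
  induction m generalizing j with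
  | zero => simp
  | succ m ih =>
    rw [pow_succ', Module.End.mul_apply]
    refine (congrArg (q ^ i * ·) (ih (j + 1))).trans ?_
    rw [add_right_comm, add_assoc, pow_succ q m, mul_pow]
    ring

/-- On functions of `l` alone, `y` acts as a shift. -/
theorem actY_pow_apply (m : ℕ) :
    (((actY n N ν q α β γ) ^ m) f).1 0 0 l = f.1 0 0 (l + m) := by
  induction m generalizing l with
  | zero => simp
  | succ m ih =>
    rw [pow_succ', Module.End.mul_apply]
    refine Eq.trans ?_ ((ih (l + 1)).trans (by rw [add_right_comm, add_assoc]))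
    simp [actY, shiftY_apply]

end Powers

open MulOpposite in
/-- The defining relations hold for the action on functions. It is a right action, whence the
opposite algebra. -/
theorem relations_act : Relations n N ν q α β γ (op (actA n N ν α β)) (op (actX n N ν q α β))
    (op (actY n N ν q α β γ)) := by
  have hn : 1 < n := h.one_lt
  have hq : IsPrimitiveRoot q n := h.primitive
  have hω : IsPrimitiveRoot (q ^ ν) n := h.primitive_pow
  have hq0 : q ≠ 0 := h.q_ne_zero
  have hxa : op (actX n N ν q α β) * op (actA n N ν α β)
      = q • (op (actA n N ν α β) * op (actX n N ν q α β)) := by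
    rw [← op_mul, ← op_mul, ← op_smul]
    congr 1
    refine LinearMap.ext fun f => Subtype.ext ?_
    funext i j l
    change q ^ (i + 1) * f.1 (i + 1) (j + 1) l = q * (q ^ i * f.1 (i + 1) (j + 1) l)
    ring
  have hya : op (actY n N ν q α β γ) * op (actA n N ν α β)
      = q⁻¹ • (op (actA n N ν α β) * op (actY n N ν q α β γ)) := by
    rw [← op_mul, ← op_mul, ← op_smul]
    congr 1
    refine LinearMap.ext fun f => Subtype.ext ?_
    funext i j l
    change shiftY ν q γ f.1 (i + 1) j l = q⁻¹ * shiftY ν q γ (shiftA f.1) i j l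
    simp only [shiftY_apply, shiftA_apply, add_right_comm i (2 * ν) 1]
    ring
  have hyx : op (actY n N ν q α β γ) * op (actX n N ν q α β)
      - (q ^ ν)⁻¹ • (op (actX n N ν q α β) * op (actY n N ν q α β γ))
      = γ • (op (actA n N ν α β) ^ (2 * ν) - 1) := by
    rw [← op_mul, ← op_mul, ← op_smul, ← op_sub, ← op_pow, ← op_one, ← op_sub, ← op_smul]
    congr 1
    refine LinearMap.ext fun f => Subtype.ext ?_
    funext i j l
    have hA := actA_pow_apply n N ν α β f i j l (2 * ν)
    change shiftX q (shiftY ν q γ f.1) i j l - (q ^ ν)⁻¹ * shiftY ν q γ (shiftX q f.1) i j l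
      = γ * ((((actA n N ν α β) ^ (2 * ν)) f).1 i j l - f.1 i j l)
    have hc : q⁻¹ ^ i * q ^ i = 1 := by rw [← mul_pow, inv_mul_cancel₀ hq0, one_pow]
    have hc2 : q ^ (2 * ν) = (q ^ ν) * (q ^ ν) := by ring
    have hν : (q ^ ν)⁻¹ * q ^ ν = 1 := inv_mul_cancel₀ (pow_ne_zero ν hq0)
    have hP : ∀ ω : k, ∑ m ∈ Finset.range (j + 1), ω ^ m
        = 1 + ω * ∑ m ∈ Finset.range j, ω ^ m := fun ω => by
      rw [Finset.sum_range_succ', Finset.mul_sum]; simp [pow_succ', add_comm]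
    simp only [hA, shiftX_apply, shiftY_apply, Nat.add_sub_cancel, pow_add q i, hc2, hP]
    rcases j with _ | j
    · simp
      field_simp
      ring
    · rw [Nat.add_sub_cancel]
      generalize ∑ m ∈ Finset.range (j + 1), (q ^ ν) ^ m = P
      generalize ∑ m ∈ Finset.range (j + 1), (q ^ ν)⁻¹ ^ m = Q
      rw [pow_succ (q ^ ν)⁻¹ (j + 1)]
      generalize (q ^ ν)⁻¹ ^ (j + 1) = w
      generalize q⁻¹ ^ i = d at hc ⊢
      generalize q ^ i = c at hc ⊢
      generalize (q ^ ν)⁻¹ = v at hν ⊢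
      generalize q ^ ν = u at hν ⊢
      linear_combination (γ * (f.1 (i + 2 * ν) (j + 1) l - f.1 i (j + 1) l)
        + γ * u * P * f.1 (i + 2 * ν) (j + 1) l * (1 - v * u)) * hc
        - γ * u * P * f.1 (i + 2 * ν) (j + 1) l * hν
  refine ⟨?_, ?_, ?_, hxa, hya, hyx⟩
  · rw [← op_pow, ← op_one]
    congr 1
    refine LinearMap.ext fun f => Subtype.ext ?_
    funext i j l
    exact (actA_pow_apply n N ν α β f i j l N).trans (f.2.1 i j l)
  · rw [← op_pow, ← op_pow, ← op_one, ← op_sub, ← op_smul]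
    congr 1
    refine LinearMap.ext fun f => Subtype.ext ?_
    funext i j l
    have hA := actA_pow_apply n N ν α β f i j l (ν * n)
    refine (actX_pow_apply n N ν q α β f i j l n).trans ?_
    rw [hq.pow_eq_one, one_pow, one_mul, f.2.2.1, ← hA]
    rfl
  · -- `yⁿ` commutes with `a` and `x`, so that it is enough to compare values at `i = j = 0`.
    have hyn : Commute (op (actY n N ν q α β γ) ^ n) (op (actA n N ν α β)) := by
      have := pow_mul_comm (A := (Module.End k (monomialFunctions n N ν α β))ᵐᵒᵖ) hya n
      rwa [inv_pow, hq.pow_eq_one, inv_one, one_smul] at this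
    have hyg : op (actY n N ν q α β γ) * op (actA n N ν α β) ^ (2 * ν)
        = ((q ^ ν)⁻¹ ^ 2) • (op (actA n N ν α β) ^ (2 * ν) * op (actY n N ν q α β γ)) := by
      refine (mul_pow_comm (A := (Module.End k (monomialFunctions n N ν α β))ᵐᵒᵖ) hya
        (2 * ν)).trans ?_
      rw [inv_pow, inv_pow, mul_comm 2 ν, pow_mul]
    have hxn : Commute (op (actY n N ν q α β γ) ^ n) (op (actX n N ν q α β)) :=
      commute_pow_of_skew_commutator
        (A := (Module.End k (monomialFunctions n N ν α β))ᵐᵒᵖ) hn hω hyg hyx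
    rw [← op_pow, ← op_pow, ← op_one, ← op_sub, ← op_smul]
    congr 1
    refine LinearMap.ext fun f => Subtype.ext ?_
    funext i j l
    have hval : ∀ (g : monomialFunctions n N ν α β) (l : ℕ), g.1 i j l
        = ((actX n N ν q α β ^ j * actA n N ν α β ^ i) g).1 0 0 l := fun g l => by
      rw [Module.End.mul_apply, actX_pow_apply, actA_pow_apply, pow_zero, one_mul, zero_add,
        zero_add]
    have hcomm : Commute (actX n N ν q α β ^ j * actA n N ν α β ^ i) (actY n N ν q α β γ ^ n) := by
      have := (hyn.pow_right i).mul_right (hxn.pow_right j)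
      simp only [← op_pow, ← op_mul] at this
      exact this.unop.symm
    rw [hval, ← Module.End.mul_apply, hcomm.eq, Module.End.mul_apply, actY_pow_apply, ← hval,
      f.2.2.2, ← actA_pow_apply n N ν α β f i j l (ν * n)]
    rfl

/-- A function in `monomialFunctions`, as a linear functional on `U_(n,N,ν,q,α,β,γ)`. -/
noncomputable def functional (f : monomialFunctions n N ν α β) : U n N ν q α β γ →ₗ[k] k :=
  LinearMap.proj 0 ∘ₗ LinearMap.proj 0 ∘ₗ LinearMap.proj 0 ∘ₗ
    (monomialFunctions n N ν α β).subtype ∘ₗ LinearMap.applyₗ f ∘ₗ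
    (MulOpposite.opLinearEquiv k).symm.toLinearMap ∘ₗ
    (U.lift (relations_act n N ν q α β γ)).toLinearMap

theorem functional_monomial (f : monomialFunctions n N ν α β) (i j l : ℕ) :
    functional n N ν q α β γ f (U.a n N ν q α β γ ^ i * U.x n N ν q α β γ ^ j *
      U.y n N ν q α β γ ^ l) = f.1 i j l := by
  have e : functional n N ν q α β γ f (U.a n N ν q α β γ ^ i * U.x n N ν q α β γ ^ j *
      U.y n N ν q α β γ ^ l) = ((actY n N ν q α β γ ^ l *
        (actX n N ν q α β ^ j * actA n N ν α β ^ i)) f).1 0 0 0 := by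
    simp [functional, ← MulOpposite.op_pow]
  rw [e, Module.End.mul_apply, actY_pow_apply, Module.End.mul_apply, actX_pow_apply,
    actA_pow_apply, pow_zero, one_mul, zero_add, zero_add, zero_add]

variable {N} in
/-- On functions of `i : ZMod N`, the operator `h ↦ c (h (i + νn) - h i)`. -/
def scaledDifference (c : k) : Module.End k (ZMod N → k) :=
  c • (LinearMap.funLeft k k (fun i => i + ((ν * n : ℕ) : ZMod N)) - 1)

variable {N} in
theorem scaledDifference_apply (c : k) (g : ZMod N → k) (i : ZMod N) :
    scaledDifference n ν c g i = c * (g (i + ((ν * n : ℕ) : ZMod N)) - g i) := rfl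

variable {N} in
theorem scaledDifference_commute (c d : k) :
    Commute (scaledDifference (N := N) n ν c) (scaledDifference n ν d) :=
  ((Commute.refl _).smul_left c).smul_right d

/-- The function in `monomialFunctions` which is the indicator function of `(i, j, l)` on the box
of reduced exponents; it vanishes if `n ≤ j` or `n ≤ l`. -/
def indicatorFunction (hn : 0 < n) (i₀ : ZMod N) (j₀ l₀ : ℕ) : monomialFunctions n N ν α β where
  val i j l := if j % n = j₀ ∧ l % n = l₀ then
      (scaledDifference n ν α ^ (j / n) * scaledDifference n ν β ^ (l / n) :
        Module.End k (ZMod N → k)) (Pi.single i₀ 1) (i : ZMod N)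
    else 0
  property := by
    have hc := scaledDifference_commute (N := N) n ν β α
    refine ⟨fun i j l => ?_, fun i j l => ?_, fun i j l => ?_⟩
    · simp
    · simp only [Nat.add_mod_right, Nat.add_div_right _ hn]
      split_ifs
      · rw [pow_succ', mul_assoc, Module.End.mul_apply, scaledDifference_apply, Nat.cast_add]
      · ring
    · simp only [Nat.add_mod_right, Nat.add_div_right _ hn]
      split_ifs
      · rw [pow_succ', ← mul_assoc, ← (hc.pow_right (j / n)).eq, mul_assoc, Module.End.mul_apply,
          scaledDifference_apply, Nat.cast_add]
      · ring

theorem indicatorFunction_apply (hn : 0 < n) (i₀ : ZMod N) (j₀ l₀ i : ℕ) {j l : ℕ} (hj : j < n)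
    (hl : l < n) : (indicatorFunction n N ν α β hn i₀ j₀ l₀).1 i j l =
      if (i : ZMod N) = i₀ ∧ j = j₀ ∧ l = l₀ then 1 else 0 := by
  simp only [indicatorFunction, Nat.mod_eq_of_lt hj, Nat.mod_eq_of_lt hl, Nat.div_eq_of_lt hj,
    Nat.div_eq_of_lt hl, pow_zero, mul_one, Module.End.one_apply, Pi.single_apply]
  split_ifs <;> tauto

/-- The coordinate of an element of `U_(n,N,ν,q,α,β,γ)` at the monomial `aⁱ xʲ yˡ`; it is `0` by
convention if `n ≤ j` or `n ≤ l`. -/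
noncomputable def coord (i : ZMod N) (j l : ℕ) : U n N ν q α β γ →ₗ[k] k :=
  functional n N ν q α β γ (indicatorFunction n N ν α β h.n_pos i j l)

variable {n N ν q α β γ}

theorem coord_monomial (i₀ : ZMod N) (j₀ l₀ i : ℕ) {j l : ℕ} (hj : j < n) (hl : l < n) :
    coord n N ν q α β γ i₀ j₀ l₀ (U.a n N ν q α β γ ^ i * U.x n N ν q α β γ ^ j *
      U.y n N ν q α β γ ^ l) = if (i : ZMod N) = i₀ ∧ j = j₀ ∧ l = l₀ then 1 else 0 := by
  rw [coord, functional_monomial, indicatorFunction_apply _ _ _ _ _ _ _ _ _ _ hj hl]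

/-- Induction on reduced monomials, for statements that are linear. -/
theorem U.monomial_induction {P : U n N ν q α β γ → Prop} (zero : P 0)
    (add : ∀ z w, P z → P w → P (z + w)) (smul : ∀ (c : k) z, P z → P (c • z))
    (monomial : ∀ i j l : ℕ, i < N → j < n → l < n → P (U.a n N ν q α β γ ^ i *
      U.x n N ν q α β γ ^ j * U.y n N ν q α β γ ^ l)) (z : U n N ν q α β γ) : P z := by
  have hz : z ∈ monomialSpan k n N (U.a n N ν q α β γ) (U.x n N ν q α β γ)
      (U.y n N ν q α β γ) := by
    rw [U.monomialSpan_eq_top h.N_pos h.n_pos h.primitive.pow_eq_one]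
    exact Submodule.mem_top
  induction hz using Submodule.span_induction with
  | mem w hw => obtain ⟨p, rfl⟩ := hw; exact monomial _ _ _ p.1.2 p.2.1.2 p.2.2.2
  | zero => exact zero
  | add v w _ _ hv hw => exact add _ _ hv hw
  | smul c w _ hw => exact smul c _ hw

theorem coord_eq_zero_of_le (i : ZMod N) {j l : ℕ} (hjl : n ≤ j ∨ n ≤ l) :
    coord n N ν q α β γ i j l = 0 := by
  refine LinearMap.ext fun z => ?_
  induction z using U.monomial_induction with
  | zero => simp
  | add z w hz hw => rw [map_add, hz, hw]; simp
  | smul c z hz => rw [map_smul, hz]; simp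
  | monomial i j l _ hj hl =>
    rw [coord_monomial _ _ _ _ hj hl, if_neg (by omega)]
    rfl

theorem linearIndependent_monomials : LinearIndependent k fun p : Fin N × Fin n × Fin n =>
    U.a n N ν q α β γ ^ (p.1 : ℕ) * U.x n N ν q α β γ ^ (p.2.1 : ℕ) *
      U.y n N ν q α β γ ^ (p.2.2 : ℕ) := by
  rw [Fintype.linearIndependent_iff]
  intro c hc p
  have hp := congrArg (coord n N ν q α β γ ((p.1 : ℕ) : ZMod N) p.2.1 p.2.2) hc
  rw [map_sum, map_zero, Finset.sum_eq_single p] at hp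
  · rwa [map_smul, coord_monomial _ _ _ _ p.2.1.2 p.2.2.2, if_pos ⟨rfl, rfl, rfl⟩, smul_eq_mul,
      mul_one] at hp
  · rintro r - hr
    rw [map_smul, coord_monomial _ _ _ _ r.2.1.2 r.2.2.2, if_neg, smul_zero]
    rintro ⟨h1, h2, h3⟩
    rw [ZMod.natCast_eq_natCast_iff'] at h1
    rw [Nat.mod_eq_of_lt r.1.2, Nat.mod_eq_of_lt p.1.2] at h1
    exact hr (Prod.ext (Fin.ext h1) (Prod.ext (Fin.ext h2) (Fin.ext h3)))
  · simp

/-- The basis of reduced monomials. -/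
noncomputable def monomialBasis : Module.Basis (Fin N × Fin n × Fin n) k (U n N ν q α β γ) :=
  Module.Basis.mk linearIndependent_monomials
    (U.monomialSpan_eq_top h.N_pos h.n_pos h.primitive.pow_eq_one).ge

theorem finite_U : Module.Finite k (U n N ν q α β γ) := Module.Finite.of_basis monomialBasis

theorem finrank_U : Module.finrank k (U n N ν q α β γ) = N * n ^ 2 := by
  rw [Module.finrank_eq_card_basis monomialBasis]
  simp [sq]

theorem sum_coord_smul (z : U n N ν q α β γ) :
    ∑ p : Fin N × Fin n × Fin n, coord n N ν q α β γ ((p.1 : ℕ) : ZMod N) p.2.1 p.2.2 z •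
      (U.a n N ν q α β γ ^ (p.1 : ℕ) * U.x n N ν q α β γ ^ (p.2.1 : ℕ) *
        U.y n N ν q α β γ ^ (p.2.2 : ℕ)) = z := by
  induction z using U.monomial_induction with
  | zero => simp
  | add z w hz hw => simp only [map_add, add_smul, Finset.sum_add_distrib, hz, hw]
  | smul c z hz => simp only [map_smul, smul_assoc, ← Finset.smul_sum, hz]
  | monomial i j l hi hj hl =>
    rw [Finset.sum_eq_single (⟨i, hi⟩, ⟨j, hj⟩, ⟨l, hl⟩)]
    · rw [coord_monomial _ _ _ _ hj hl, if_pos ⟨rfl, rfl, rfl⟩, one_smul]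
    · rintro r - hr
      rw [coord_monomial _ _ _ _ hj hl, if_neg, zero_smul]
      rintro ⟨h1, h2, h3⟩
      rw [ZMod.natCast_eq_natCast_iff', Nat.mod_eq_of_lt r.1.2, Nat.mod_eq_of_lt hi] at h1
      exact hr (Prod.ext (Fin.ext h1.symm) (Prod.ext (Fin.ext h2.symm) (Fin.ext h3.symm)))
    · simp

/-- An element all of whose coordinates vanish is zero. -/
theorem eq_zero_of_coord {z : U n N ν q α β γ}
    (hz : ∀ (i : ZMod N) (j l : ℕ), coord n N ν q α β γ i j l z = 0) : z = 0 := by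
  rw [← sum_coord_smul z]
  exact Finset.sum_eq_zero fun p _ => by rw [hz, zero_smul]

/-- An element without coordinates at monomials involving `x` or `y` commutes with `a`. -/
theorem commute_a_of_coord {z : U n N ν q α β γ}
    (hz : ∀ (i : ZMod N) (j l : ℕ), 0 < j + l → coord n N ν q α β γ i j l z = 0) :
    Commute z (U.a n N ν q α β γ) := by
  rw [← sum_coord_smul z]
  refine Commute.sum_left _ _ _ fun p _ => ?_
  rcases Nat.eq_zero_or_pos ((p.2.1 : ℕ) + p.2.2) with h0 | h0
  · obtain ⟨h1, h2⟩ := Nat.add_eq_zero_iff.mp h0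
    rw [h1, h2, pow_zero, pow_zero, mul_one, mul_one]
    exact (Commute.pow_self _ _).smul_left _
  · rw [hz _ _ _ h0, zero_smul]
    exact Commute.zero_left _

end Model

/-! ### The comultiplication in coordinates -/

section Comul

theorem gaussCoeff_one_right {k : Type*} [Field k] (ω : k) (m : ℕ) :
    gaussCoeff ω m 1 = ∑ i ∈ Finset.range m, ω ^ i := by
  induction m with
  | zero => rfl
  | succ m ih =>
    rw [gaussCoeff_succ_succ, ih, gaussCoeff_zero_right, Finset.sum_range_succ', Finset.mul_sum]
    simp [pow_succ', add_comm]

theorem gaussCoeff_one_ne_zero {k : Type*} [Field k] {ω : k} {n m : ℕ} (hω : IsPrimitiveRoot ω n)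
    (hm : 0 < m) (hmn : m < n) : gaussCoeff ω m 1 ≠ 0 := by
  intro h0
  have h1 := mul_geom_sum ω m
  rw [← gaussCoeff_one_right, h0, mul_zero] at h1
  exact hω.pow_ne_one_of_pos_of_lt hm.ne' hmn (sub_eq_zero.mp h1.symm)

variable {k : Type u} [Field k] {n N ν : ℕ} {q α β γ : k}

/-- The `q`-binomial expansion of `Δ (aⁱ xʲ yˡ)`. -/
theorem Relations.tensor_monomial {A : Type*} [Ring A] [Algebra k A] {a x y : A}
    (h : Relations n N ν q α β γ a x y) (i j l : ℕ) :
    (a ⊗ₜ[k] a) ^ i * (x ⊗ₜ[k] (a ^ ν) + 1 ⊗ₜ[k] x) ^ j * (y ⊗ₜ[k] (a ^ ν) + 1 ⊗ₜ[k] y) ^ l =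
      ∑ u ∈ Finset.range (j + 1), ∑ v ∈ Finset.range (l + 1),
        (gaussCoeff (q ^ ν) j u * gaussCoeff (q⁻¹ ^ ν) l v * q ^ (ν * v * (j - u))) •
          ((a ^ i * x ^ u * y ^ v) ⊗ₜ[k]
            (a ^ (i + ν * (u + v)) * x ^ (j - u) * y ^ (l - v)) : A ⊗[k] A) := by
  have hx : ((1 : A) ⊗ₜ[k] x) * (x ⊗ₜ[k] (a ^ ν)) = q ^ ν • ((x ⊗ₜ[k] (a ^ ν)) * (1 ⊗ₜ[k] x)) := by
    simp [mul_pow_comm h.x_a]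
  have hy : ((1 : A) ⊗ₜ[k] y) * (y ⊗ₜ[k] (a ^ ν))
      = q⁻¹ ^ ν • ((y ⊗ₜ[k] (a ^ ν)) * (1 ⊗ₜ[k] y)) := by
    simp [mul_pow_comm h.y_a]
  rw [add_pow_eq_sum hx, add_pow_eq_sum hy, mul_assoc, Finset.sum_mul_sum]
  simp only [Finset.mul_sum]
  refine Finset.sum_congr rfl fun u _ => Finset.sum_congr rfl fun v _ => ?_
  have hc : x ^ (j - u) * (a ^ ν) ^ v = q ^ (ν * v * (j - u)) • ((a ^ ν) ^ v * x ^ (j - u)) := by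
    rw [← pow_mul, pow_mul_comm (mul_pow_comm h.x_a (ν * v)), ← pow_mul]
  have hr : a ^ i * ((a ^ ν) ^ u * x ^ (j - u) * ((a ^ ν) ^ v * y ^ (l - v)))
      = q ^ (ν * v * (j - u)) • (a ^ (i + ν * (u + v)) * x ^ (j - u) * y ^ (l - v)) := by
    rw [mul_assoc _ (x ^ _), ← mul_assoc (x ^ _), hc, pow_add, mul_add, pow_add, pow_mul a ν u,
      pow_mul a ν v]
    simp only [mul_smul_comm, smul_mul_assoc, mul_assoc]
  simp only [Algebra.TensorProduct.tmul_pow, Algebra.TensorProduct.tmul_mul_tmul, one_pow, mul_one,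
    mul_smul_comm, smul_mul_assoc, smul_smul]
  rw [hr, TensorProduct.tmul_smul, smul_smul, mul_assoc (a ^ i), mul_comm (gaussCoeff _ l v)]

variable [h : Admissible n N ν q]

theorem comul_monomial (i j l : ℕ) :
    Coalgebra.comul (R := k) (U.a n N ν q α β γ ^ i * U.x n N ν q α β γ ^ j *
      U.y n N ν q α β γ ^ l) =
      ∑ u ∈ Finset.range (j + 1), ∑ v ∈ Finset.range (l + 1),
        (gaussCoeff (q ^ ν) j u * gaussCoeff (q⁻¹ ^ ν) l v * q ^ (ν * v * (j - u))) •
          ((U.a n N ν q α β γ ^ i * U.x n N ν q α β γ ^ u * U.y n N ν q α β γ ^ v) ⊗ₜ[k]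
            (U.a n N ν q α β γ ^ (i + ν * (u + v)) * U.x n N ν q α β γ ^ (j - u) *
              U.y n N ν q α β γ ^ (l - v))) := by
  rw [← (U.relations n N ν q α β γ).tensor_monomial, U.comul_def, map_mul, map_mul, map_pow,
    map_pow, map_pow, U.comulHom, U.lift_a, U.lift_x, U.lift_y]

/-- The tensor product of two coordinate functionals. -/
noncomputable def coordTensor (i : ZMod N) (j l : ℕ) (i' : ZMod N) (j' l' : ℕ) :
    U n N ν q α β γ ⊗[k] U n N ν q α β γ →ₗ[k] k :=
  LinearMap.mul' k k ∘ₗ TensorProduct.map (coord n N ν q α β γ i j l) (coord n N ν q α β γ i' j' l')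

@[simp] theorem coordTensor_tmul (i : ZMod N) (j l : ℕ) (i' : ZMod N) (j' l' : ℕ)
    (z w : U n N ν q α β γ) : coordTensor i j l i' j' l' (z ⊗ₜ[k] w)
      = coord n N ν q α β γ i j l z * coord n N ν q α β γ i' j' l' w := by
  simp [coordTensor]

/-- The comultiplication in coordinates. In particular it is graded by the degrees in `x` and `y`,
and does not depend on `α`, `β`, `γ`. -/
theorem coordTensor_comul (i : ZMod N) (j l : ℕ) (i' : ZMod N) (j' l' : ℕ)
    (z : U n N ν q α β γ) : coordTensor i j l i' j' l' (Coalgebra.comul (R := k) z)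
      = if i' = i + (ν * (j + l) : ℕ) then
          gaussCoeff (q ^ ν) (j + j') j * gaussCoeff (q⁻¹ ^ ν) (l + l') l * q ^ (ν * l * j') *
            coord n N ν q α β γ i (j + j') (l + l') z
        else 0 := by
  induction z using U.monomial_induction with
  | zero => simp
  | add z w hz hw =>
    rw [map_add, map_add, hz, hw, map_add]
    split_ifs
    · ring
    · ring
  | smul c z hz =>
    rw [map_smul, map_smul, hz, map_smul, smul_eq_mul, smul_eq_mul]
    split_ifs
    · ring
    · ring
  | monomial i₀ j₀ l₀ hi hj hl =>
    rw [comul_monomial, map_sum, coord_monomial _ _ _ _ hj hl]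
    have hterm : ∀ u ∈ Finset.range (j₀ + 1), ∀ v ∈ Finset.range (l₀ + 1),
        coordTensor (α := α) (β := β) (γ := γ) (h := h) i j l i' j' l'
          ((gaussCoeff (q ^ ν) j₀ u * gaussCoeff (q⁻¹ ^ ν) l₀ v * q ^ (ν * v * (j₀ - u))) •
          ((U.a n N ν q α β γ ^ i₀ * U.x n N ν q α β γ ^ u * U.y n N ν q α β γ ^ v) ⊗ₜ[k]
            (U.a n N ν q α β γ ^ (i₀ + ν * (u + v)) * U.x n N ν q α β γ ^ (j₀ - u) *
              U.y n N ν q α β γ ^ (l₀ - v))))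
        = if u = j then if v = l then
            if i' = i + (ν * (j + l) : ℕ) ∧ (i₀ : ZMod N) = i ∧ j₀ = j + j' ∧ l₀ = l + l' then
            gaussCoeff (q ^ ν) (j + j') j * gaussCoeff (q⁻¹ ^ ν) (l + l') l * q ^ (ν * l * j')
            else 0 else 0 else 0 := by
      intro u hu v hv
      rw [Finset.mem_range] at hu hv
      rw [map_smul, coordTensor_tmul, coord_monomial _ _ _ _ (by omega) (by omega),
        coord_monomial _ _ _ _ (by omega) (by omega)]
      by_cases hu' : u = j
      · by_cases hv' : v = l
        · subst hu' hv'
          rw [if_pos rfl, if_pos rfl]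
          by_cases hi₀ : (i₀ : ZMod N) = i
          · by_cases hj' : j₀ = u + j'
            · by_cases hl' : l₀ = v + l'
              · subst hi₀ hj' hl'
                simp [eq_comm]
              · rw [if_neg (by tauto : ¬ (i' = _ ∧ _)), if_neg (by omega : ¬ (_ ∧ _ ∧ l₀ - v = l'))]
                simp
            · rw [if_neg (by tauto : ¬ (i' = _ ∧ _)),
                if_neg (by omega : ¬ (_ ∧ j₀ - u = j' ∧ _))]
              simp
          · rw [if_neg (by tauto : ¬ (i' = _ ∧ _)), if_neg (by tauto : ¬ ((i₀ : ZMod N) = i ∧ _))]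
            simp
        · simp [hv']
      · simp [hu']
    rw [Finset.sum_congr rfl fun u hu => by
      rw [map_sum, Finset.sum_congr rfl fun v hv => hterm u hu v hv]]
    simp only [Finset.sum_ite_irrel, Finset.sum_const_zero, Finset.sum_ite_eq', Finset.mem_range]
    by_cases hc : i' = i + (ν * (j + l) : ℕ)
    · by_cases hd : (i₀ : ZMod N) = i ∧ j₀ = j + j' ∧ l₀ = l + l'
      · rw [if_pos (by omega), if_pos (by omega), if_pos ⟨hc, hd⟩, if_pos hc, if_pos hd, mul_one]
      · rw [if_neg (by tauto : ¬ (i' = _ ∧ _)), if_neg hd, mul_zero, ite_self, ite_self, ite_self]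
    · rw [if_neg (by tauto : ¬ (i' = _ ∧ _)), if_neg hc, ite_self, ite_self]

end Comul

/-! ### Group-like and skew-primitive elements -/

section GroupLike

variable {k : Type u} [Field k] {n N ν : ℕ} {q α β γ : k} [h : Admissible n N ν q]

theorem coord_a_pow (r : ℕ) (i : ZMod N) (j l : ℕ) :
    coord n N ν q α β γ i j l (U.a n N ν q α β γ ^ r)
      = if (r : ZMod N) = i ∧ 0 = j ∧ 0 = l then 1 else 0 := by
  have := coord_monomial (α := α) (β := β) (γ := γ) (h := h) i j l r h.n_pos h.n_pos
  simpa using this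

theorem coord_a_pow_mul_x (r : ℕ) (i : ZMod N) (j l : ℕ) :
    coord n N ν q α β γ i j l (U.a n N ν q α β γ ^ r * U.x n N ν q α β γ)
      = if (r : ZMod N) = i ∧ 1 = j ∧ 0 = l then 1 else 0 := by
  have := coord_monomial (α := α) (β := β) (γ := γ) (h := h) i j l r h.one_lt h.n_pos
  simpa using this

theorem coord_a_pow_mul_y (r : ℕ) (i : ZMod N) (j l : ℕ) :
    coord n N ν q α β γ i j l (U.a n N ν q α β γ ^ r * U.y n N ν q α β γ)
      = if (r : ZMod N) = i ∧ 0 = j ∧ 1 = l then 1 else 0 := by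
  have := coord_monomial (α := α) (β := β) (γ := γ) (h := h) i j l r h.n_pos h.one_lt
  simpa using this

theorem coord_x (i : ZMod N) (j l : ℕ) : coord n N ν q α β γ i j l (U.x n N ν q α β γ)
      = if 0 = i ∧ 1 = j ∧ 0 = l then 1 else 0 := by
  simpa using coord_a_pow_mul_x (α := α) (β := β) (γ := γ) (h := h) 0 i j l

theorem coord_y (i : ZMod N) (j l : ℕ) : coord n N ν q α β γ i j l (U.y n N ν q α β γ)
      = if 0 = i ∧ 0 = j ∧ 1 = l then 1 else 0 := by
  simpa using coord_a_pow_mul_y (α := α) (β := β) (γ := γ) (h := h) 0 i j l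

theorem a_pow_eq_one_iff (r : ℕ) : U.a n N ν q α β γ ^ r = 1 ↔ N ∣ r := by
  constructor
  · intro hr
    have h1 := coord_a_pow (α := α) (β := β) (γ := γ) (h := h) r 0 0 0
    have h2 := coord_a_pow (α := α) (β := β) (γ := γ) (h := h) 0 0 0 0
    rw [hr, ← pow_zero (U.a n N ν q α β γ), h2] at h1
    by_contra hN
    rw [← ZMod.natCast_eq_zero_iff] at hN
    simp [hN] at h1
  · rintro ⟨c, rfl⟩
    rw [pow_mul, (U.relations n N ν q α β γ).a_pow, one_pow]

theorem x_ne_zero : U.x n N ν q α β γ ≠ 0 := by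
  intro h0
  have := coord_x (α := α) (β := β) (γ := γ) (h := h) 0 1 0
  simp [h0] at this

/-- The group-like elements are the powers of `a`. -/
theorem eq_a_pow_of_comul_eq_tmul_self {g : U n N ν q α β γ} (hg0 : g ≠ 0)
    (hg : Coalgebra.comul (R := k) g = g ⊗ₜ[k] g) : ∃ r : ℕ, g = U.a n N ν q α β γ ^ r := by
  have key : ∀ i j l i' j' l', coord n N ν q α β γ i j l g * coord n N ν q α β γ i' j' l' g
      = if i' = i + (ν * (j + l) : ℕ) then
          gaussCoeff (q ^ ν) (j + j') j * gaussCoeff (q⁻¹ ^ ν) (l + l') l * q ^ (ν * l * j') *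
            coord n N ν q α β γ i (j + j') (l + l') g
        else 0 := fun i j l i' j' l' => by
    rw [← coordTensor_comul, hg, coordTensor_tmul]
  -- The square of a coordinate in degree `d` is, up to a factor, a coordinate in degree `2 d`
  -- or `0`: descending induction on the degree, starting above the top degree.
  have hdeg : ∀ (d j l : ℕ) (i : ZMod N), 0 < j + l → 2 * n ≤ j + l + d →
      coord n N ν q α β γ i j l g = 0 := by
    intro d
    induction d with
    | zero =>
      intro j l i _ hd
      rw [coord_eq_zero_of_le i (by omega)]
      rfl
    | succ d ih =>
      intro j l i hpos hd
      refine mul_self_eq_zero.mp ?_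
      rw [key, ih (j + j) (l + l) i (by omega) (by omega), mul_zero, ite_self]
  have hdeg' : ∀ (i : ZMod N) (j l : ℕ), 0 < j + l → coord n N ν q α β γ i j l g = 0 :=
    fun i j l hjl => hdeg (2 * n) j l i hjl (by omega)
  have h00 : ∀ i i', coord n N ν q α β γ i 0 0 g * coord n N ν q α β γ i' 0 0 g
      = if i' = i then coord n N ν q α β γ i 0 0 g else 0 := by
    intro i i'
    rw [key]
    simp [gaussCoeff_zero_right]
  obtain ⟨i, hi⟩ : ∃ i, coord n N ν q α β γ i 0 0 g ≠ 0 := by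
    by_contra! hall
    refine hg0 (eq_zero_of_coord fun i j l => ?_)
    rcases Nat.eq_zero_or_pos (j + l) with h0 | h0
    · obtain ⟨rfl, rfl⟩ := Nat.add_eq_zero_iff.mp h0
      exact hall i
    · exact hdeg' i j l h0
  have hNN : NeZero N := ⟨h.N_pos.ne'⟩
  refine ⟨i.val, sub_eq_zero.mp (eq_zero_of_coord fun i' j l => ?_)⟩
  rw [map_sub, coord_a_pow, ZMod.natCast_zmod_val]
  rcases Nat.eq_zero_or_pos (j + l) with h0 | h0
  · obtain ⟨rfl, rfl⟩ := Nat.add_eq_zero_iff.mp h0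
    by_cases hii : i = i'
    · subst hii
      have := h00 i i
      rw [if_pos rfl] at this
      rw [if_pos ⟨rfl, rfl, rfl⟩, mul_right_cancel₀ hi (this.trans (one_mul _).symm), sub_self]
    · have := h00 i i'
      rw [if_neg (Ne.symm hii)] at this
      rw [(mul_eq_zero.mp this).resolve_left hi, if_neg (by tauto), sub_self]
  · rw [hdeg' i' j l h0, if_neg (by omega), sub_self]

/-- A skew-primitive element `z`, with `Δ z = z ⊗ aᵐ + 1 ⊗ z`, is a combination of `x` and `y` up
to an element of the group algebra; if `aᵐ ≠ a^ν` it lies in the group algebra. -/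
theorem exists_eq_of_skewPrimitive {z : U n N ν q α β γ} {m : ℕ}
    (hz : Coalgebra.comul (R := k) z = z ⊗ₜ[k] (U.a n N ν q α β γ ^ m) + 1 ⊗ₜ[k] z) :
    ∃ (s t : k) (w : U n N ν q α β γ), z = s • U.x n N ν q α β γ + t • U.y n N ν q α β γ + w ∧
      (∀ (i : ZMod N) (j l : ℕ), 0 < j + l → coord n N ν q α β γ i j l w = 0) ∧
      ((m : ZMod N) ≠ ν → s = 0 ∧ t = 0) := by
  have hν : IsPrimitiveRoot (q ^ ν) n := h.primitive_pow
  have hν' : IsPrimitiveRoot (q⁻¹ ^ ν) n := by rw [inv_pow]; exact hν.inv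
  have key : ∀ (i : ZMod N) (j l : ℕ) (i' : ZMod N) (j' l' : ℕ),
      (if i' = i + (ν * (j + l) : ℕ) then
          gaussCoeff (q ^ ν) (j + j') j * gaussCoeff (q⁻¹ ^ ν) (l + l') l * q ^ (ν * l * j') *
            coord n N ν q α β γ i (j + j') (l + l') z
        else 0)
      = coord n N ν q α β γ i j l z * (if (m : ZMod N) = i' ∧ 0 = j' ∧ 0 = l' then 1 else 0)
        + (if (0 : ZMod N) = i ∧ 0 = j ∧ 0 = l then 1 else 0) * coord n N ν q α β γ i' j' l' z := by
    intro i j l i' j' l'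
    have h1 := coord_a_pow (α := α) (β := β) (γ := γ) (h := h) 0 i j l
    rw [pow_zero, Nat.cast_zero] at h1
    rw [← coordTensor_comul, hz, map_add, coordTensor_tmul, coordTensor_tmul, coord_a_pow, h1]
  -- Splitting off `aⁱ` on the left.
  have hi0 : ∀ (i : ZMod N) (j l : ℕ), i ≠ 0 → 0 < j + l → coord n N ν q α β γ i j l z = 0 := by
    intro i j l hi hjl
    have := key i 0 0 i j l
    rw [if_pos (by simp), if_neg (by omega), if_neg (by tauto)] at this
    simpa [gaussCoeff_zero_right] using this
  -- Splitting off `x`, respectively `y`, on the left.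
  have hj : ∀ j l : ℕ, 0 < j + l ∨ (m : ZMod N) ≠ ν → coord n N ν q α β γ 0 (j + 1) l z = 0 := by
    intro j l hjl
    rcases le_or_gt n (j + 1) with hn | hn
    · rw [coord_eq_zero_of_le 0 (Or.inl hn)]
      rfl
    have := key 0 1 0 ν j l
    rw [if_pos (by simp), if_neg (by rcases hjl with h1 | h1; exacts [by omega, by tauto]),
      if_neg (by simp)] at this
    have hg := gaussCoeff_one_ne_zero hν (Nat.succ_pos j) hn
    rw [Nat.succ_eq_add_one, add_comm j 1] at hg
    rw [add_comm j 1]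
    simpa [gaussCoeff_zero_right, hg] using this
  have hl : ∀ l : ℕ, 0 < l ∨ (m : ZMod N) ≠ ν → coord n N ν q α β γ 0 0 (l + 1) z = 0 := by
    intro l hl
    rcases le_or_gt n (l + 1) with hn | hn
    · rw [coord_eq_zero_of_le 0 (Or.inr hn)]
      rfl
    have := key 0 0 1 ν 0 l
    rw [if_pos (by simp), if_neg (by rcases hl with h1 | h1; exacts [by omega, by tauto]),
      if_neg (by simp)] at this
    have hg := gaussCoeff_one_ne_zero hν' (Nat.succ_pos l) hn
    rw [Nat.succ_eq_add_one, add_comm l 1] at hg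
    rw [add_comm l 1]
    rw [inv_pow] at hg
    simpa [gaussCoeff_zero_right, hg] using this
  refine ⟨coord n N ν q α β γ 0 1 0 z, coord n N ν q α β γ 0 0 1 z,
    z - (coord n N ν q α β γ 0 1 0 z • U.x n N ν q α β γ
      + coord n N ν q α β γ 0 0 1 z • U.y n N ν q α β γ), by abel, fun i j l hjl => ?_,
    fun hm => ⟨hj 0 0 (Or.inr hm), hl 0 (Or.inr hm)⟩⟩
  simp only [map_sub, map_add, map_smul, coord_x, coord_y, smul_eq_mul]
  by_cases hi : i = 0
  · subst hi
    rcases j with _ | j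
    · rcases l with _ | l
      · omega
      · rcases Nat.eq_zero_or_pos l with rfl | hl0
        · simp
        · rw [hl l (Or.inl hl0), if_neg (by omega), if_neg (by omega)]; simp
    · rcases Nat.eq_zero_or_pos (j + l) with h0 | h0
      · obtain ⟨rfl, rfl⟩ := Nat.add_eq_zero_iff.mp h0
        simp
      · rw [hj j l (Or.inl h0), if_neg (by omega), if_neg (by omega)]; simp
  · rw [hi0 i j l hi hjl, if_neg (by tauto), if_neg (by tauto)]; simp

/-- Among the skew-primitive elements, those which `aʳ` rescales by a factor `c ≠ 1` are
combinations of `x` and `y`. -/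
theorem exists_eq_of_skewPrimitive_of_scaled {z : U n N ν q α β γ} {m r : ℕ} {c : k} (hc : c ≠ 1)
    (hz : Coalgebra.comul (R := k) z = z ⊗ₜ[k] (U.a n N ν q α β γ ^ m) + 1 ⊗ₜ[k] z)
    (hzr : z * U.a n N ν q α β γ ^ r = c • (U.a n N ν q α β γ ^ r * z)) :
    ∃ s t : k, z = s • U.x n N ν q α β γ + t • U.y n N ν q α β γ ∧
      s * (q ^ r - c) = 0 ∧ t * (q⁻¹ ^ r - c) = 0 ∧ ((m : ZMod N) ≠ ν → s = 0 ∧ t = 0) := by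
  obtain ⟨s, t, w, hzw, hw, hst⟩ := exists_eq_of_skewPrimitive hz
  have hR := U.relations n N ν q α β γ
  have hcomm : w * U.a n N ν q α β γ ^ r = U.a n N ν q α β γ ^ r * w :=
    (commute_a_of_coord hw).pow_right r
  have hzero : U.a n N ν q α β γ ^ r * ((s * (q ^ r - c)) • U.x n N ν q α β γ
      + (t * (q⁻¹ ^ r - c)) • U.y n N ν q α β γ + (1 - c) • w) = 0 := by
    rw [hzw, add_mul, add_mul, hcomm, smul_mul_assoc, smul_mul_assoc, mul_pow_comm hR.x_a,
      mul_pow_comm hR.y_a, ← sub_eq_zero] at hzr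
    rw [← hzr]
    simp only [mul_add, mul_smul_comm, smul_add, smul_smul, mul_sub, sub_smul, one_smul,
      mul_comm c]
    abel
  have hunit : ∀ v : U n N ν q α β γ, U.a n N ν q α β γ ^ r * v = 0 → v = 0 := fun v hv => by
    rw [← one_mul v, ← U.a_inv_mul n N ν q α β γ r, mul_assoc, hv, mul_zero]
  have h0 := hunit _ hzero
  have hs := congrArg (coord n N ν q α β γ 0 1 0) h0
  have ht := congrArg (coord n N ν q α β γ 0 0 1) h0
  simp [coord_x, coord_y, hw] at hs ht
  have hw0 : w = 0 := by
    have h1 : (s * (q ^ r - c)) = 0 := mul_eq_zero.mpr hs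
    have h2 : (t * (q⁻¹ ^ r - c)) = 0 := by rw [inv_pow]; exact mul_eq_zero.mpr ht
    rw [h1, h2, zero_smul, zero_smul, zero_add, zero_add] at h0
    exact (smul_eq_zero.mp h0).resolve_left (sub_ne_zero.mpr hc.symm)
  refine ⟨s, t, by rw [hzw, hw0, add_zero], mul_eq_zero.mpr hs, ?_, hst⟩
  rw [inv_pow]
  exact mul_eq_zero.mpr ht

end GroupLike

/-! ### Isomorphisms -/

section Isomorphism

variable {k : Type u} [Field k] {n N ν : ℕ} {q α β γ α' β' γ' : k} [h : Admissible n N ν q]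

/-- For `n > 2`, a Hopf algebra isomorphism rescales `x` and `y` separately. -/
theorem exists_scalars_of_bialgEquiv (hn : 2 < n)
    (e : U n N ν q α β γ ≃ₐc[k] U n N ν q α' β' γ') :
    ∃ s t : k, α = s ^ n * α' ∧ β = t ^ n * β' ∧ γ = s * t * γ' := by
  have hR := U.relations n N ν q α β γ
  have hR' := U.relations n N ν q α' β' γ'
  have hq := h.primitive
  have hcomul : ∀ z, Coalgebra.comul (R := k) (e z)
      = TensorProduct.map (e : U n N ν q α β γ →ₗ[k] U n N ν q α' β' γ')
          (e : U n N ν q α β γ →ₗ[k] U n N ν q α' β' γ') (Coalgebra.comul (R := k) z) := fun z =>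
    (CoalgHomClass.map_comp_comul_apply e z).symm
  have hinj : Function.Injective e := e.injective
  have ha0 : e (U.a n N ν q α β γ) ≠ 0 := by
    intro h0
    have h1 : e (U.a n N ν q α β γ ^ N) = 0 := by rw [map_pow, h0, zero_pow h.N_pos.ne']
    rw [hR.a_pow, map_one] at h1
    refine x_ne_zero (α := α') (β := β') (γ := γ') (h := h) ?_
    rw [← one_mul (U.x n N ν q α' β' γ'), h1, zero_mul]
  obtain ⟨r, hr⟩ := eq_a_pow_of_comul_eq_tmul_self ha0 (by
    rw [hcomul, U.comul_def, U.comulHom, U.lift_a, TensorProduct.map_tmul]; rfl)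
  have hx : Coalgebra.comul (R := k) (e (U.x n N ν q α β γ))
      = e (U.x n N ν q α β γ) ⊗ₜ[k] (U.a n N ν q α' β' γ' ^ (r * ν))
        + 1 ⊗ₜ[k] e (U.x n N ν q α β γ) := by
    rw [hcomul, U.comul_def, U.comulHom, U.lift_x, map_add, TensorProduct.map_tmul,
      TensorProduct.map_tmul, pow_mul, ← hr, ← map_pow, ← map_one e]
    rfl
  have hy : Coalgebra.comul (R := k) (e (U.y n N ν q α β γ))
      = e (U.y n N ν q α β γ) ⊗ₜ[k] (U.a n N ν q α' β' γ' ^ (r * ν))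
        + 1 ⊗ₜ[k] e (U.y n N ν q α β γ) := by
    rw [hcomul, U.comul_def, U.comulHom, U.lift_y, map_add, TensorProduct.map_tmul,
      TensorProduct.map_tmul, pow_mul, ← hr, ← map_pow, ← map_one e]
    rfl
  have hq1 : q ≠ 1 := hq.ne_one h.one_lt
  have hq1' : q⁻¹ ≠ 1 := hq.inv.ne_one h.one_lt
  -- This is where `n > 2` enters.
  have hqq : q⁻¹ ≠ q := by
    intro h2
    refine hq.pow_ne_one_of_pos_of_lt two_ne_zero hn ?_
    rw [sq]
    nth_rewrite 1 [← h2]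
    exact inv_mul_cancel₀ h.q_ne_zero
  obtain ⟨s, t', hxe, hs, ht', hxm⟩ := exists_eq_of_skewPrimitive_of_scaled (r := r) hq1 hx (by
    rw [← hr, ← map_mul, hR.x_a, map_smul, map_mul])
  obtain ⟨s', t, hye, hs', ht, -⟩ := exists_eq_of_skewPrimitive_of_scaled (r := r) hq1' hy (by
    rw [← hr, ← map_mul, hR.y_a, map_smul, map_mul])
  have hrν : ((r * ν : ℕ) : ZMod N) = (ν : ℕ) := by
    by_contra hne
    obtain ⟨rfl, rfl⟩ := hxm hne
    rw [zero_smul, zero_smul, zero_add, ← map_zero e] at hxe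
    exact x_ne_zero (hinj hxe)
  have hmod : r * ν ≡ ν [MOD N] := (ZMod.natCast_eq_natCast_iff _ _ _).mp hrν
  have hqr : q ^ r = q := by
    have h1 : r * ν ≡ 1 * ν [MOD n] := by rw [one_mul]; exact hmod.of_dvd h.dvd
    have h2 : r ≡ 1 [MOD n] := Nat.ModEq.cancel_right_of_coprime h.coprime h1
    rw [← pow_mod_orderOf q r, ← hq.eq_orderOf, show r % n = 1 % n from h2, hq.eq_orderOf,
      pow_mod_orderOf, pow_one]
  have hapow : ∀ m : ℕ, e (U.a n N ν q α β γ ^ (m * ν)) = U.a n N ν q α' β' γ' ^ (m * ν) := by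
    intro m
    rw [map_pow, hr, ← pow_mul, ← pow_mod_orderOf, ← pow_mod_orderOf _ (m * ν)]
    congr 1
    have h1 : r * (m * ν) ≡ m * ν [MOD N] := by
      rw [mul_left_comm]; exact hmod.mul_left m
    exact h1.of_dvd (orderOf_dvd_of_pow_eq_one hR'.a_pow)
  rw [inv_pow, hqr] at ht' ht
  rw [hqr] at hs'
  have ht0 : t' = 0 := (mul_eq_zero.mp ht').resolve_right (sub_ne_zero.mpr hqq)
  have hs0 : s' = 0 := (mul_eq_zero.mp hs').resolve_right (sub_ne_zero.mpr hqq.symm)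
  rw [ht0, zero_smul, add_zero] at hxe
  rw [hs0, zero_smul, zero_add] at hye
  have hνn : U.a n N ν q α' β' γ' ^ (ν * n) - 1 ≠ 0 :=
    sub_ne_zero.mpr fun h1 => h.not_dvd ((a_pow_eq_one_iff _).mp h1)
  have h2ν : U.a n N ν q α' β' γ' ^ (2 * ν) - 1 ≠ 0 := by
    refine sub_ne_zero.mpr fun h1 => ?_
    have h2 : n ∣ 2 * ν := h.dvd.trans ((a_pow_eq_one_iff _).mp h1)
    exact absurd (Nat.le_of_dvd two_pos (h.coprime.dvd_of_dvd_mul_right h2)) (by omega)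
  refine ⟨s, t, ?_, ?_, ?_⟩
  · have h1 := congrArg e hR.x_pow
    rw [map_pow, hxe, smul_pow, hR'.x_pow, map_smul, map_sub, mul_comm ν n, hapow, map_one,
      smul_smul, mul_comm n ν] at h1
    exact (smul_left_injective k hνn h1).symm
  · have h1 := congrArg e hR.y_pow
    rw [map_pow, hye, smul_pow, hR'.y_pow, map_smul, map_sub, mul_comm ν n, hapow, map_one,
      smul_smul, mul_comm n ν] at h1
    exact (smul_left_injective k hνn h1).symm
  · have h1 := congrArg e hR.y_x
    rw [map_sub, map_smul, map_mul, map_mul, hxe, hye, smul_mul_smul_comm, smul_mul_smul_comm,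
      mul_comm t s, smul_comm, ← smul_sub, hR'.y_x, map_smul, map_sub, hapow, map_one,
      smul_smul] at h1
    exact (smul_left_injective k h2ν h1).symm

/-- For `n > 2`, the quotient `αβ / γⁿ`, written without division, is an invariant of the Hopf
algebra `U_(n,N,ν,q,α,β,γ)`. -/
theorem invariant_of_bialgEquiv (hn : 2 < n)
    (e : U n N ν q α β γ ≃ₐc[k] U n N ν q α' β' γ') :
    α * β * γ' ^ n = α' * β' * γ ^ n := by
  obtain ⟨s, t, rfl, rfl, rfl⟩ := exists_scalars_of_bialgEquiv hn e
  ring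

theorem isEmpty_bialgEquiv_of_ne (hn : 2 < n) (hα : α ≠ α') :
    IsEmpty (U n N ν q α 1 1 ≃ₐc[k] U n N ν q α' 1 1) :=
  ⟨fun e => hα (by simpa using invariant_of_bialgEquiv hn e)⟩

end Isomorphism

theorem admissible_one {k : Type u} [Field k] {n N : ℕ} {q : k} (hn : 1 < n) (hnN : n < N)
    (hd : n ∣ N) (hq : IsPrimitiveRoot q n) : Admissible n N 1 q where
  one_lt := hn
  dvd := hd
  one_le := le_rfl
  lt := hn.trans hnN
  coprime := Nat.coprime_one_right n
  not_dvd hN := absurd (Nat.le_of_dvd (by omega) hN) (by omega)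
  primitive := hq

theorem not_finitelyManyHopfAlgebras {k : Type u} [Field k] [Infinite k] {n N : ℕ} {q : k}
    (hn : 2 < n) (hnN : n < N) (hd : n ∣ N) (hq : IsPrimitiveRoot q n) :
    ¬ FinitelyManyHopfAlgebras k (N * n ^ 2) := by
  rintro ⟨m, H, hH⟩
  have := admissible_one (by omega) hnN hd hq
  choose f hf using fun α : k => hH (U n N 1 q α 1 1) finite_U finrank_U
  obtain ⟨α, α', hne, hff⟩ := Finite.exists_ne_map_eq_of_infinite f
  obtain ⟨e⟩ := hf α
  obtain ⟨e'⟩ := hf α'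
  rw [← hff] at e'
  exact (isEmpty_bialgEquiv_of_ne hn hne).false (e.trans e'.symm)

end GelakiHopf

theorem corollary3p2 (k : Type u) [Field k] [Infinite k] :
    ((∃ n : ℕ, 2 < n ∧ ∃ q : k, IsPrimitiveRoot q n) →
      ¬ GelakiHopf.KaplanskyTenthConjecture k) ∧
    ∀ (n N : ℕ) (q : k), 2 < n → n < N → n ∣ N → IsPrimitiveRoot q n →
      ¬ GelakiHopf.FinitelyManyHopfAlgebras k (N * n ^ 2) ∧
      (∃ ν : ℕ, GelakiHopf.Admissible n N ν q) ∧
      ∀ (ν : ℕ) [GelakiHopf.Admissible n N ν q],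
        (∀ α β γ : k, α ≠ 0 → β ≠ 0 → γ ≠ 0 →
          Module.Finite k (GelakiHopf.U n N ν q α β γ) ∧
          Module.finrank k (GelakiHopf.U n N ν q α β γ) = N * n ^ 2) ∧
        ∃ S : Set (k × k × k), S.Infinite ∧
          (∀ p ∈ S, p.1 ≠ 0 ∧ p.2.1 ≠ 0 ∧ p.2.2 ≠ 0) ∧
          S.Pairwise fun p p' =>
            IsEmpty (GelakiHopf.U n N ν q p.1 p.2.1 p.2.2 ≃ₐc[k]
              GelakiHopf.U n N ν q p'.1 p'.2.1 p'.2.2) := by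
  refine ⟨?_, fun n N q hn hnN hd hq => ⟨GelakiHopf.not_finitelyManyHopfAlgebras hn hnN hd hq,
    ⟨1, GelakiHopf.admissible_one (by omega) hnN hd hq⟩, fun ν _ =>
    ⟨fun α β γ _ _ _ => ⟨GelakiHopf.finite_U, GelakiHopf.finrank_U⟩,
      (fun α => (α, 1, 1)) '' {0}ᶜ, ?_, ?_, ?_⟩⟩⟩
  · rintro ⟨n, hn, q, hq⟩ hK
    exact GelakiHopf.not_finitelyManyHopfAlgebras (N := 2 * n) hn (by omega) ⟨2, mul_comm 2 n⟩ hq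
      (hK _)
  · exact (Set.finite_singleton (0 : k)).infinite_compl.image fun α _ α' _ hαα' =>
      congrArg Prod.fst hαα'
  · rintro _ ⟨α, hα, rfl⟩
    exact ⟨hα, one_ne_zero, one_ne_zero⟩
  · rintro _ ⟨α, -, rfl⟩ _ ⟨α', -, rfl⟩ hne
    exact GelakiHopf.isEmpty_bialgEquiv_of_ne hn fun hα =>
      hne (congrArg (fun c : k => (c, (1 : k), (1 : k))) hα)
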